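/- By a curve over a field $K$ we mean a smooth projective geometrically irreducible variety of dimension $1$ over $K$. Let $C$ be a curve over $\mathbb{Q}$. For an algebraic point $P\in C(\overline{\mathbb{Q}})$ let $\mathbb{Q}(P)$ be its field of definition; $P$ has degree $d$ if $[\mathbb{Q}(P):\mathbb{Q}]=d$, and $P$ is primitive if there is no field $L$ with $\mathbb{Q}\subsetneq L\subsetneq\mathbb{Q}(P)$. Theorem. Let $\pi : C\to C'$ be a non-constant morphism of curves defined over $\mathbb{Q}$. Let $m$ be the degree of $\pi$, let $g$, $g'$ be the genera of $C$, $C'$ respectively, and suppose $g'\ge 1$. Let $J$ be the Jacobian of $C$ and suppose that $J(\mathbb{Q})$ is finite. Let $d$ be a positive integer with $$g > m g' + (m-1)(d-1).$$ Then $C$ has only finitely many primitive points of degree $d$. Moreover, if $\gcd(d,m)=1$ or $d$ is prime, then $C$ has only finitely many points of degree $d$. -/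

import Mathlib

open CategoryTheory CategoryTheory.Limits AlgebraicGeometry

universe u

noncomputable section

/-- A curve over a field `K`: a smooth proper geometrically integral `K`-scheme of dimension `1`.
(A proper curve is automatically projective, and a smooth geometrically irreducible scheme is
automatically geometrically integral.) -/
structure Curve (K : Type u) [Field K] where
  /-- the underlying scheme -/
  X : Scheme.{u}
  /-- the structure morphism -/
  f : X ⟶ Spec (.of K)
  smooth : SmoothOfRelativeDimension 1 f
  proper : IsProper f
  geometricallyIntegral : GeometricallyIntegral f

namespace Curve

attribute [instance] Curve.smooth Curve.proper Curve.geometricallyIntegral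

section Geometry

variable {K : Type u} [Field K] (C : Curve K)

instance : IsIntegral C.X := GeometricallyIntegral.isIntegral_of_subsingleton C.f

instance : IsLocallyNoetherian C.X := LocallyOfFiniteType.isLocallyNoetherian C.f

/-- The closed points (equivalently: the points of codimension one) of a curve. -/
def ClosedPoint : Type u := {x : C.X // Order.coheight x = 1}

/-- The group of (Weil) divisors. -/
abbrev Divisor : Type u := C.ClosedPoint →₀ ℤ

/-- The degree of a divisor: `∑ D(x) [κ(x) : K]`. -/
def degree : C.Divisor →+ ℤ :=
  Finsupp.liftAddHom fun x => AddMonoidHom.mulRight (C.f.residueDegree x.1 : ℤ)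

/-- The divisors of nonzero rational functions. -/
def principalDivisors : AddSubgroup C.Divisor where
  carrier := {D | ∃ h : C.X.functionField, h ≠ 0 ∧
    ∀ x : C.ClosedPoint, D x = Scheme.ord h x.1}
  zero_mem' := ⟨1, one_ne_zero, fun x => by
    have h := Scheme.ord_mul (X := C.X) (x := x.1) (one_ne_zero) (one_ne_zero)
    rw [mul_one] at h
    simp only [Finsupp.coe_zero, Pi.zero_apply]
    linarith⟩
  add_mem' := by
    rintro D E ⟨h, hh, hD⟩ ⟨k, hk, hE⟩
    exact ⟨h * k, mul_ne_zero hh hk, fun x => by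
      rw [Finsupp.add_apply, hD, hE, Scheme.ord_mul hh hk]⟩
  neg_mem' := by
    rintro D ⟨h, hh, hD⟩
    refine ⟨h⁻¹, inv_ne_zero hh, fun x => ?_⟩
    have h1 := Scheme.ord_mul (X := C.X) (x := x.1) hh (inv_ne_zero hh)
    have h2 := Scheme.ord_mul (X := C.X) (x := x.1) (one_ne_zero) (one_ne_zero)
    rw [mul_inv_cancel₀ hh] at h1
    rw [mul_one] at h2
    rw [Finsupp.neg_apply, hD]
    linarith

/-- The divisor class group (Picard group) of a curve. -/
abbrev DivisorClass : Type u := C.Divisor ⧸ C.principalDivisors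

/-- The embedding of the base field in the function field, as constant functions. -/
def constants : K →+* C.X.functionField :=
  haveI : Nonempty (⊤ : C.X.Opens) := ⟨⟨genericPoint C.X, trivial⟩⟩
  ((Scheme.ΓSpecIso (.of K)).inv ≫ C.f.appTop ≫ C.X.germToFunctionField ⊤).hom

instance : Algebra K C.X.functionField := C.constants.toAlgebra

/-- The Riemann–Roch space `L(D) = {h | h = 0 or div h + D ≥ 0}`. The set on the right is already
a `K`-subspace, because the local rings are discrete valuation rings containing `K`; taking its
span only packages it as one. -/
def riemannRochSpace (D : C.Divisor) : Submodule K C.X.functionField :=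
  Submodule.span K {h | h ≠ 0 ∧ ∀ x : C.ClosedPoint, 0 ≤ Scheme.ord h x.1 + D x}

/-- `ℓ(D) = dim L(D)`. -/
def ell (D : C.Divisor) : ℕ := Module.finrank K (C.riemannRochSpace D)

/-- The genus: the maximum of `deg D - ℓ(D) + 1` over all divisors `D`. (By Riemann's theorem
the maximum exists; the value at `D = 0` is `0`.) -/
def genus : ℕ := sSup {n : ℕ | ∃ D : C.Divisor, (n : ℤ) = C.degree D - C.ell D + 1}

end Geometry

section Rational

variable (C : Curve ℚ)

/-- The field of algebraic numbers. -/
abbrev Qbar : Type := AlgebraicClosure ℚ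

/-- The morphism `Spec Qbar ⟶ Spec ℚ`. -/
abbrev specQbar : Spec (.of Qbar) ⟶ Spec (.of ℚ) :=
  Spec.map (CommRingCat.ofHom (algebraMap ℚ Qbar))

/-- The base change of a curve over `ℚ` to the field of algebraic numbers. -/
def geometricFibre : Curve Qbar where
  X := pullback C.f specQbar
  f := pullback.snd C.f specQbar
  smooth := (smoothOfRelativeDimension_isStableUnderBaseChange 1).of_isPullback
    (IsPullback.of_hasPullback C.f specQbar) C.smooth
  proper := inferInstance
  geometricallyIntegral := inferInstance

/-- The automorphism `Spec σ` of `Spec Qbar`. -/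
abbrev specGal (σ : Qbar ≃ₐ[ℚ] Qbar) : Spec (.of Qbar) ⟶ Spec (.of Qbar) :=
  Spec.map (CommRingCat.ofHom (σ : Qbar →+* Qbar))

lemma specGal_comp (σ : Qbar ≃ₐ[ℚ] Qbar) : specGal σ ≫ specQbar = specQbar := by
  rw [← Spec.map_comp, ← CommRingCat.ofHom_comp]
  congr 2
  exact σ.toAlgHom.comp_algebraMap

instance (σ : Qbar ≃ₐ[ℚ] Qbar) : IsIso (specGal σ) := by
  have : IsIso (CommRingCat.ofHom (σ : Qbar →+* Qbar)) :=
    (σ.toRingEquiv.toCommRingCatIso).isIso_hom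
  infer_instance

/-- The automorphism `id × Spec σ` of the base change of `C`. -/
def galHom (σ : Qbar ≃ₐ[ℚ] Qbar) : C.geometricFibre.X ⟶ C.geometricFibre.X :=
  pullback.map C.f specQbar C.f specQbar (𝟙 _) (specGal σ) (𝟙 _) (by simp)
    (by rw [specGal_comp, Category.comp_id])

instance (σ : Qbar ≃ₐ[ℚ] Qbar) : IsIso (C.galHom σ) := by
  unfold galHom
  exact pullback.map_isIso _ _ _ _ _ _ _ _ _

/-- The action of `σ` on the closed points of the base change of `C`. -/
def galPoint (σ : Qbar ≃ₐ[ℚ] Qbar) (x : C.geometricFibre.ClosedPoint) :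
    C.geometricFibre.ClosedPoint :=
  ⟨C.galHom σ x.1, (coheight_eq_of_isOpenImmersion (C.galHom σ)).trans x.2⟩

/-- The action of `σ` on divisors. -/
def galDivisor (σ : Qbar ≃ₐ[ℚ] Qbar) :
    C.geometricFibre.Divisor →+ C.geometricFibre.Divisor :=
  Finsupp.mapDomain.addMonoidHom (C.galPoint σ)

/-- The group `J(ℚ)` of rational points of the Jacobian `J` of `C`: the group
`Pic⁰(C_Qbar)^Gal(Qbar/ℚ)` of Galois-invariant divisor classes of degree `0`
on the base change of `C`. -/
def jacobianPoints : AddSubgroup C.geometricFibre.DivisorClass :=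
  AddSubgroup.map (QuotientAddGroup.mk' C.geometricFibre.principalDivisors)
    { carrier := {D | C.geometricFibre.degree D = 0 ∧
        ∀ σ : Qbar ≃ₐ[ℚ] Qbar, C.galDivisor σ D - D ∈ C.geometricFibre.principalDivisors}
      zero_mem' := by simp
      add_mem' := by
        rintro D E ⟨hD, hD'⟩ ⟨hE, hE'⟩
        refine ⟨by rw [map_add, hD, hE, add_zero], fun σ => ?_⟩
        rw [map_add, add_sub_add_comm]
        exact add_mem (hD' σ) (hE' σ)
      neg_mem' := by
        rintro D ⟨hD, hD'⟩
        refine ⟨by rw [map_neg, hD, neg_zero], fun σ => ?_⟩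
        rw [map_neg, neg_sub_neg, ← neg_sub]
        exact neg_mem (hD' σ) }

/-- The set `C(Qbar)` of algebraic points. -/
def AlgebraicPoint : Type := {P : Spec (.of Qbar) ⟶ C.X // P ≫ C.f = specQbar}

variable {C}

/-- The field `ℚ(P)`: the image in `Qbar` of the residue field at the image of `P`. -/
def AlgebraicPoint.field (P : C.AlgebraicPoint) : IntermediateField ℚ Qbar :=
  (Scheme.SpecToEquivOfField Qbar C.X P.1).2.hom.fieldRange.toIntermediateField
    fun q => by
      rw [eq_ratCast]
      exact SubfieldClass.ratCast_mem _ q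

/-- `P` has degree `d` if `[ℚ(P) : ℚ] = d`. -/
def AlgebraicPoint.HasDegree (P : C.AlgebraicPoint) (d : ℕ) : Prop :=
  Module.finrank ℚ P.field = d

/-- `P` is primitive if there is no field strictly between `ℚ` and `ℚ(P)`. -/
def AlgebraicPoint.IsPrimitive (P : C.AlgebraicPoint) : Prop :=
  ∀ L : IntermediateField ℚ Qbar, ¬ (⊥ < L ∧ L < P.field)

end Rational

section Morphisms

variable {K : Type u} [Field K]

/-- Morphisms of curves over `K`. -/
structure Hom (C C' : Curve K) where
  /-- the underlying morphism of schemes -/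
  toHom : C.X ⟶ C'.X
  comp_f : toHom ≫ C'.f = C.f

variable {C C' : Curve K}

/-- A morphism is non-constant if its image has more than one point. -/
def Hom.Nonconstant (π : C.Hom C') : Prop := (Set.range π.toHom).Nontrivial

/-- The degree `[K(C) : K(C')]` of a (non-constant) morphism of curves. -/
def Hom.deg (π : C.Hom C') : ℕ := π.toHom.residueDegree (genericPoint C.X)

end Morphisms

end Curve

end

open Module

/-- A normalized discrete valuation of a field extension `F/K`, trivial on `K`. The order of `0` is
set to `0`. -/
structure OrderFunction (K F : Type*) [Field K] [Field F] [Algebra K F] where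
  /-- the order of a function -/
  ord : F → ℤ
  ord_zero : ord 0 = 0
  ord_mul : ∀ {f g : F}, f ≠ 0 → g ≠ 0 → ord (f * g) = ord f + ord g
  ord_add : ∀ {f g : F}, f + g ≠ 0 → min (ord f) (ord g) ≤ ord (f + g)
  ord_algebraMap : ∀ c : K, ord (algebraMap K F c) = 0
  exists_ord_eq_one : ∃ t : F, ord t = 1

namespace OrderFunction

variable {K F : Type*} [Field K] [Field F] [Algebra K F] (P : OrderFunction K F)

lemma ord_one : P.ord 1 = 0 := by simpa using P.ord_algebraMap 1

lemma ne_zero_of_ord_ne_zero {f : F} (hf : P.ord f ≠ 0) : f ≠ 0 := by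
  rintro rfl
  exact hf P.ord_zero

lemma ord_inv (f : F) : P.ord f⁻¹ = -P.ord f := by
  by_cases hf : f = 0
  · simp [hf, P.ord_zero]
  have h := P.ord_mul hf (inv_ne_zero hf)
  rw [mul_inv_cancel₀ hf, P.ord_one] at h
  linarith

lemma ord_pow (f : F) (n : ℕ) : P.ord (f ^ n) = n * P.ord f := by
  by_cases hf : f = 0
  · rcases n with _ | n <;> simp [hf, P.ord_zero, P.ord_one]
  induction n with
  | zero => simp [P.ord_one]
  | succ n ih =>
    rw [pow_succ, P.ord_mul (pow_ne_zero _ hf) hf, ih]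
    push_cast
    ring

lemma ord_zpow (f : F) (n : ℤ) : P.ord (f ^ n) = n * P.ord f := by
  rcases n with n | n
  · simp [P.ord_pow]
  · rw [zpow_negSucc, P.ord_inv, P.ord_pow, Int.negSucc_eq]
    push_cast
    ring

/-- The `K`-subspace of functions of order at least `n`. -/
def filtration (n : ℤ) : Submodule K F where
  carrier := {f | f = 0 ∨ n ≤ P.ord f}
  zero_mem' := Or.inl rfl
  add_mem' := by
    rintro f g (rfl | hf) (rfl | hg)
    · simp
    · simp [hg]
    · simp [hf]
    · by_cases h : f + g = 0
      · exact Or.inl h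
      · exact Or.inr ((le_min hf hg).trans (P.ord_add h))
  smul_mem' := by
    rintro c f (rfl | hf)
    · simp
    by_cases h : c • f = 0
    · exact Or.inl h
    obtain ⟨hc, hf0⟩ := smul_ne_zero_iff.mp h
    refine Or.inr ?_
    rw [Algebra.smul_def, P.ord_mul (by simpa using hc) hf0, P.ord_algebraMap, zero_add]
    exact hf

lemma mem_filtration {n : ℤ} {f : F} : f ∈ P.filtration n ↔ f = 0 ∨ n ≤ P.ord f := Iff.rfl

lemma mem_filtration_of_ne_zero {n : ℤ} {f : F} (hf : f ≠ 0) :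
    f ∈ P.filtration n ↔ n ≤ P.ord f := by
  simp [mem_filtration, hf]

lemma filtration_anti {m n : ℤ} (h : m ≤ n) : P.filtration n ≤ P.filtration m :=
  fun _ hf => hf.imp id h.trans

lemma mul_mem_filtration {m n : ℤ} {f g : F} (hf : f ∈ P.filtration m)
    (hg : g ∈ P.filtration n) : f * g ∈ P.filtration (m + n) := by
  by_cases hf0 : f = 0
  · simp [hf0]
  by_cases hg0 : g = 0
  · simp [hg0]
  rw [mem_filtration_of_ne_zero _ hf0] at hf
  rw [mem_filtration_of_ne_zero _ hg0] at hg
  refine Or.inr ?_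
  rw [P.ord_mul hf0 hg0]
  exact add_le_add hf hg

lemma mul_mem_filtration_iff {m n : ℤ} {t f : F} (ht : t ≠ 0) (hm : P.ord t = m) :
    t * f ∈ P.filtration (m + n) ↔ f ∈ P.filtration n := by
  refine ⟨fun h => ?_, fun h => P.mul_mem_filtration (Or.inr hm.ge) h⟩
  have := P.mul_mem_filtration (m := -m) (f := t⁻¹) (Or.inr (by rw [P.ord_inv, hm])) h
  rwa [inv_mul_cancel_left₀ ht, neg_add_cancel_left] at this

lemma algebraMap_mem_filtration (c : K) : algebraMap K F c ∈ P.filtration 0 :=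
  Or.inr (P.ord_algebraMap c).ge

/-- The valuation ring of a place. -/
def integers : Subalgebra K F where
  carrier := P.filtration 0
  mul_mem' hf hg := by simpa using P.mul_mem_filtration hf hg
  add_mem' := add_mem
  algebraMap_mem' := P.algebraMap_mem_filtration

lemma mem_integers {f : F} : f ∈ P.integers ↔ f ∈ P.filtration 0 := Iff.rfl

lemma aeval_mem_integers {f : F} (hf : f ∈ P.integers) (p : Polynomial K) :
    Polynomial.aeval f p ∈ P.integers :=
  Polynomial.aeval_subalgebra_coe p P.integers ⟨f, hf⟩ ▸ Subtype.prop _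

/-- A function of nonzero order is transcendental. -/
lemma transcendental_of_ord_ne_zero {f : F} (hf : P.ord f ≠ 0) : Transcendental K f := by
  wlog h : 0 < P.ord f generalizing f
  · have := this (f := f⁻¹) (by rw [P.ord_inv]; omega) (by rw [P.ord_inv]; omega)
    exact fun h => this h.inv
  rintro ⟨p, hp0, hp⟩
  obtain ⟨n, q, hq, rfl⟩ : ∃ (n : ℕ) (q : Polynomial K), q.coeff 0 ≠ 0 ∧
      p = Polynomial.X ^ n * q := by
    obtain ⟨q, hq, hq'⟩ := Polynomial.exists_eq_pow_rootMultiplicity_mul_and_not_dvd p hp0 0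
    refine ⟨_, q, ?_, by simpa using hq⟩
    rwa [map_zero, sub_zero, Polynomial.X_dvd_iff] at hq'
  have hf0 := P.ne_zero_of_ord_ne_zero hf
  rw [map_mul, map_pow, Polynomial.aeval_X, mul_eq_zero, or_iff_right (pow_ne_zero _ hf0)] at hp
  rw [← Polynomial.divX_mul_X_add q, map_add, map_mul, Polynomial.aeval_X, Polynomial.aeval_C,
    add_eq_zero_iff_eq_neg, ← map_neg] at hp
  have h1 := P.mul_mem_filtration (P.aeval_mem_integers (P.mem_integers.mpr (Or.inr h.le)) q.divX)
    (P.mem_filtration.mpr (Or.inr (le_refl (P.ord f))))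
  rw [hp, zero_add, P.mem_filtration_of_ne_zero (by simpa using hq), P.ord_algebraMap] at h1
  omega

end OrderFunction

/-- A discrete place of `F/K` together with its residue field `κ`. -/
structure DiscretePlace (K F κ : Type*) [Field K] [Field F] [Field κ] [Algebra K F]
    [Algebra K κ] extends OrderFunction K F where
  /-- the residue map -/
  res : toOrderFunction.integers →ₐ[K] κ
  res_surjective : Function.Surjective res
  res_eq_zero_iff : ∀ f, res f = 0 ↔ (f : F) ∈ toOrderFunction.filtration 1

namespace DiscretePlace

variable {K F κ : Type*} [Field K] [Field F] [Field κ] [Algebra K F] [Algebra K κ]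
  (P : DiscretePlace K F κ)

/-- The leading coefficient map on functions of order at least `n`, relative to a function `t`
with `n + ord t = 0`. -/
noncomputable def leadingCoeff (n : ℤ) (t : F) (hn : n + P.ord t = 0) :
    P.filtration n →ₗ[K] κ :=
  P.res.toLinearMap ∘ₗ ((LinearMap.mulLeft K t).restrict
    (q := Subalgebra.toSubmodule P.integers) (fun f hf => by
      have := P.mul_mem_filtration (f := t) (Or.inr le_rfl) hf
      rwa [add_comm, hn] at this))

lemma leadingCoeff_eq_zero_iff {n : ℤ} {t : F} (hn : n + P.ord t = 0) (ht : t ≠ 0)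
    (f : P.filtration n) : P.leadingCoeff n t hn f = 0 ↔ (f : F) ∈ P.filtration (n + 1) := by
  have h1 : (1 : ℤ) = P.ord t + (n + 1) := by omega
  rw [← P.mul_mem_filtration_iff ht rfl, ← h1]
  exact P.res_eq_zero_iff _

end DiscretePlace

open Module

namespace PlaceFamily

variable {K F X : Type*} [Field K] [Field F] [Algebra K F] {κ : X → Type*} [∀ x, Field (κ x)]
  [∀ x, Algebra K (κ x)] (P : ∀ x, DiscretePlace K F (κ x))

/-- The Riemann–Roch space of a divisor. -/
def space (D : X →₀ ℤ) : Submodule K F := ⨅ x, (P x).filtration (-D x)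

/-- The degree of a divisor. -/
noncomputable def deg (K : Type*) [Field K] {X : Type*} (κ : X → Type*) [∀ x, Field (κ x)]
    [∀ x, Algebra K (κ x)] : (X →₀ ℤ) →+ ℤ :=
  Finsupp.liftAddHom fun x => AddMonoidHom.mulRight (finrank K (κ x) : ℤ)

lemma deg_single (x : X) (n : ℤ) : deg K κ (Finsupp.single x n) = n * finrank K (κ x) := by
  simp [deg]

lemma deg_mono {D E : X →₀ ℤ} (h : D ≤ E) : deg K κ D ≤ deg K κ E := by
  rw [← sub_nonneg, ← map_sub]
  simp only [deg, Finsupp.liftAddHom_apply, AddMonoidHom.coe_mulRight]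
  exact Finset.sum_nonneg fun x _ => mul_nonneg (by simpa using h x) (by positivity)

lemma mem_space {D : X →₀ ℤ} {f : F} : f ∈ space P D ↔ ∀ x, f ∈ (P x).filtration (-D x) := by
  simp [space]

lemma mem_space_iff {D : X →₀ ℤ} {f : F} :
    f ∈ space P D ↔ f = 0 ∨ ∀ x, 0 ≤ (P x).ord f + D x := by
  by_cases hf : f = 0
  · simp [hf]
  · simp [mem_space, hf, OrderFunction.mem_filtration, neg_le_iff_add_nonneg]

lemma space_mono {D E : X →₀ ℤ} (h : D ≤ E) : space P D ≤ space P E :=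
  iInf_mono fun x => (P x).filtration_anti (neg_le_neg (h x))

lemma mul_mem_space {D E : X →₀ ℤ} {f g : F} (hf : f ∈ space P D) (hg : g ∈ space P E) :
    f * g ∈ space P (D + E) := by
  rw [mem_space] at *
  intro x
  rw [Finsupp.add_apply, neg_add]
  exact (P x).mul_mem_filtration (hf x) (hg x)

lemma one_mem_space_zero : (1 : F) ∈ space P 0 :=
  (mem_space_iff P).mpr (Or.inr fun x => by simp [(P x).ord_one])

lemma pow_mem_space {D : X →₀ ℤ} {f : F} (hf : f ∈ space P D) (n : ℕ) :
    f ^ n ∈ space P (n • D) := by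
  induction n with
  | zero => simpa using one_mem_space_zero P
  | succ n ih =>
    rw [pow_succ, succ_nsmul]
    exact mul_mem_space P ih hf

/-- The dimension of a Riemann–Roch space. -/
noncomputable def ell (D : X →₀ ℤ) : ℕ := finrank K (space P D)

lemma exists_space_add_single (D : X →₀ ℤ) (x : X) :
    ∃ φ : space P (D + Finsupp.single x 1) →ₗ[K] κ x,
      ∀ f, φ f = 0 ↔ (f : F) ∈ space P D := by
  obtain ⟨t, ht⟩ := (P x).exists_ord_eq_one
  have ht0 : t ≠ 0 := (P x).ne_zero_of_ord_ne_zero (by omega)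
  have hn : -(D x + 1) + (P x).ord (t ^ (D x + 1)) = 0 := by
    rw [(P x).ord_zpow, ht]
    ring
  refine ⟨(P x).leadingCoeff _ _ hn ∘ₗ Submodule.inclusion (fun f hf => ?_), fun f => ?_⟩
  · simpa using (mem_space P).mp hf x
  · rw [LinearMap.comp_apply, DiscretePlace.leadingCoeff_eq_zero_iff _ _ (zpow_ne_zero _ ht0),
      Submodule.coe_inclusion, show -(D x + 1) + 1 = -D x by ring]
    refine ⟨fun h => (mem_space P).mpr fun y => ?_, fun h => (mem_space P).mp h x⟩
    by_cases hy : x = y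
    · exact hy ▸ h
    · simpa [Finsupp.single_eq_of_ne' hy] using (mem_space P).mp f.2 y

variable [∀ x, FiniteDimensional K (κ x)]

lemma finite_and_ell_add_single_le (D : X →₀ ℤ) (x : X) (h : FiniteDimensional K (space P D)) :
    FiniteDimensional K (space P (D + Finsupp.single x 1)) ∧
      ell P (D + Finsupp.single x 1) ≤ ell P D + finrank K (κ x) := by
  obtain ⟨φ, hφ⟩ := exists_space_add_single P D x
  have hle : space P D ≤ space P (D + Finsupp.single x 1) := space_mono P (by
    simp [Finsupp.single_nonneg])
  have hker : LinearMap.ker φ = (space P D).comap (space P (D + Finsupp.single x 1)).subtype := by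
    ext f
    exact hφ f
  have e : space P D ≃ₗ[K] LinearMap.ker φ :=
    (Submodule.comapSubtypeEquivOfLe hle).symm.trans (LinearEquiv.ofEq _ _ hker.symm)
  have hk : FiniteDimensional K (LinearMap.ker φ) := e.finiteDimensional
  have hfin : FiniteDimensional K (space P (D + Finsupp.single x 1)) :=
    haveI := Module.Finite.equiv φ.quotKerEquivRange.symm
    Module.Finite.of_submodule_quotient (LinearMap.ker φ)
  refine ⟨hfin, ?_⟩
  have h1 := LinearMap.finrank_range_add_finrank_ker φ
  have h2 := Submodule.finrank_le (LinearMap.range φ)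
  have h3 := e.finrank_eq
  simp only [ell]
  omega

lemma finite_and_ell_le {D E : X →₀ ℤ} (hDE : D ≤ E) (h : FiniteDimensional K (space P D)) :
    FiniteDimensional K (space P E) ∧ (ell P E : ℤ) ≤ ell P D + deg K κ (E - D) := by
  obtain ⟨G, hG, rfl⟩ : ∃ G : X →₀ ℤ, 0 ≤ G ∧ E = D + G := ⟨E - D, sub_nonneg.mpr hDE, by simp⟩
  obtain ⟨G, rfl⟩ : ∃ G' : X →₀ ℕ, G = G'.mapRange (Nat.cast : ℕ → ℤ) rfl :=
    ⟨G.mapRange Int.toNat rfl, by ext x; simpa using hG x⟩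
  clear hG hDE
  rw [add_sub_cancel_left]
  induction G using Finsupp.induction_linear generalizing D with
  | zero => rw [Finsupp.mapRange_zero, add_zero, map_zero, add_zero]; exact ⟨h, le_rfl⟩
  | add G H hG hH =>
    obtain ⟨h1, h2⟩ := hG h
    obtain ⟨h3, h4⟩ := hH h1
    rw [Finsupp.mapRange_add (by simp), ← add_assoc]
    refine ⟨h3, h4.trans ?_⟩
    rw [map_add]
    linarith
  | single x n =>
    rw [Finsupp.mapRange_single]
    induction n with
    | zero =>
      rw [Nat.cast_zero, Finsupp.single_zero, add_zero, map_zero, add_zero]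
      exact ⟨h, le_rfl⟩
    | succ n ih =>
      obtain ⟨h1, h2⟩ := ih
      obtain ⟨h3, h4⟩ := finite_and_ell_add_single_le P _ x h1
      rw [Nat.cast_succ, Finsupp.single_add, ← add_assoc]
      refine ⟨h3, ?_⟩
      rw [map_add, deg_single, deg_single]
      rw [deg_single] at h2
      have : (ell P (D + Finsupp.single x (n : ℤ) + Finsupp.single x 1) : ℤ) ≤
        ell P (D + Finsupp.single x (n : ℤ)) + finrank K (κ x) := mod_cast h4
      linarith

/-- `g` is the maximum of `deg D - ℓ(D) + 1`. -/
structure IsGenus (g : ℤ) : Prop where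
  finite : ∀ D, FiniteDimensional K (space P D)
  le : ∀ D, deg K κ D - ell P D + 1 ≤ g
  exists_eq : ∃ D, deg K κ D - ell P D + 1 = g

variable {P}

/-- If the numbers `deg D - ℓ(D) + 1` have a positive supremum (with junk value `0`), then
it is a maximum. -/
lemma isGenus_sSup [Nonempty X]
    (hg : 1 ≤ sSup {n : ℕ | ∃ D : X →₀ ℤ, (n : ℤ) = deg K κ D - ell P D + 1}) :
    IsGenus P (sSup {n : ℕ | ∃ D : X →₀ ℤ, (n : ℤ) = deg K κ D - ell P D + 1} : ℕ) := by
  set S := {n : ℕ | ∃ D : X →₀ ℤ, (n : ℤ) = deg K κ D - ell P D + 1} with hS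
  have hbdd : BddAbove S := by
    by_contra h
    rw [Nat.sSup_of_not_bddAbove h] at hg
    omega
  have hne : S.Nonempty := by
    by_contra h
    rw [Set.not_nonempty_iff_eq_empty.mp h, csSup_empty] at hg
    exact absurd hg (by simp)
  have hle : ∀ D, deg K κ D - ell P D + 1 ≤ (sSup S : ℕ) := by
    intro D
    by_contra! h
    have h0 : 0 ≤ deg K κ D - ell P D + 1 := le_trans (by positivity) h.le
    have := le_csSup hbdd (show (deg K κ D - ell P D + 1).toNat ∈ S from ⟨D, by simp [h0]⟩)
    omega
  refine ⟨fun D => ?_, hle, ?_⟩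
  · by_contra hD
    obtain ⟨x⟩ := ‹Nonempty X›
    let N : ℕ := (sSup S - deg K κ D).toNat
    have hDE : D ≤ D + Finsupp.single x (N : ℤ) := by simp [Finsupp.single_nonneg]
    have h1 : ¬ FiniteDimensional K (space P (D + Finsupp.single x (N : ℤ))) := fun h =>
      hD (Submodule.finiteDimensional_of_le (space_mono P hDE))
    have h2 : ell P (D + Finsupp.single x (N : ℤ)) = 0 :=
      finrank_of_infinite_dimensional h1
    have h3 := hle (D + Finsupp.single x (N : ℤ))
    rw [h2, map_add, deg_single] at h3
    have h4 : (0 : ℤ) < finrank K (κ x) := mod_cast finrank_pos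
    have h5 : (N : ℤ) ≤ N * finrank K (κ x) := le_mul_of_one_le_right (by positivity) h4
    have h6 := Int.self_le_toNat (sSup S - deg K κ D)
    push_cast at h3
    omega
  · obtain ⟨D, hD⟩ := Nat.sSup_mem hne hbdd
    exact ⟨D, hD.symm⟩

lemma IsGenus.exists_forall_ge {g : ℤ} (h : IsGenus P g) :
    ∃ D₀, ∀ D, D₀ ≤ D → (ell P D : ℤ) = deg K κ D + 1 - g := by
  obtain ⟨D₀, hD₀⟩ := h.exists_eq
  refine ⟨D₀, fun D hD => ?_⟩
  have h1 := (finite_and_ell_le P hD (h.finite D₀)).2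
  have h2 := h.le D
  rw [map_sub] at h1
  linarith

end PlaceFamily

open Module

section LinearAlgebra

variable {K F : Type*} [Field K] [Field F] [Algebra K F]

open Polynomial IntermediateField IntermediateField.algebraAdjoinAdjoin in
/-- A family is linearly independent over `K(t)` if every relation with coefficients in `K[t]`
has coefficients divisible by `t`. -/
lemma linearIndependent_adjoin_simple {ι : Type*} [Fintype ι] {w : ι → F} {t : F} (ht : t ≠ 0)
    (h : ∀ p : ι → K[X], ∑ i, aeval t (p i) * w i = 0 → ∀ i, (p i).coeff 0 = 0) :
    LinearIndependent K⟮t⟯ w := by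
  have key : ∀ (n : ℕ) (p : ι → K[X]), ∑ i, aeval t (p i) * w i = 0 → ∀ i, (p i).coeff n = 0 := by
    intro n
    induction n with
    | zero => exact h
    | succ n ih =>
      intro p hp i
      rw [← coeff_divX]
      refine ih (fun i => (p i).divX) ?_ i
      have h0 := h p hp
      rw [← mul_right_inj' ht, mul_zero, Finset.mul_sum, ← hp]
      refine Finset.sum_congr rfl fun i _ => ?_
      conv_rhs => rw [← divX_mul_X_add (p i), h0 i]
      simp
      ring
  refine (LinearIndependent.iff_fractionRing (Algebra.adjoin K {t}) K⟮t⟯).mp ?_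
  rw [Fintype.linearIndependent_iff]
  intro c hc i
  have hex : ∀ i, ∃ p : K[X], aeval t p = (c i : F) := fun i =>
    (Algebra.adjoin_singleton_eq_range_aeval K t).le (c i).2
  choose p hp using hex
  have hp0 : p i = 0 := by
    ext n
    refine key n p ?_ i
    rw [← hc]
    exact Finset.sum_congr rfl fun i _ => by rw [hp]; rfl
  apply Subtype.ext
  rw [← hp, hp0, map_zero]
  rfl

/-- A basis of a complement of a subspace. -/
lemma exists_independent_modulo {V : Type*} [AddCommGroup V] [Module K V] {A B : Submodule K V}
    (hAB : A ≤ B) [FiniteDimensional K B] :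
    ∃ w : Fin (finrank K B - finrank K A) → V, (∀ i, w i ∈ B) ∧
      ∀ c : Fin (finrank K B - finrank K A) → K, ∑ i, c i • w i ∈ A → c = 0 := by
  set A' : Submodule K B := A.comap B.subtype with hA'
  have h1 : finrank K (B ⧸ A') = finrank K B - finrank K A := by
    rw [Submodule.finrank_quotient, (Submodule.comapSubtypeEquivOfLe hAB).finrank_eq]
  let b := finBasisOfFinrankEq K (B ⧸ A') h1
  choose w hw using fun i => A'.mkQ_surjective (b i)
  refine ⟨fun i => w i, fun i => (w i).2, fun c hc => ?_⟩
  have h2 : ∑ i, c i • w i ∈ A' := by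
    rw [hA', Submodule.mem_comap]
    simpa using hc
  have h3 : ∑ i, c i • b i = 0 := by
    rw [← (Submodule.Quotient.mk_eq_zero A').mpr h2, ← Submodule.mkQ_apply, map_sum]
    exact Finset.sum_congr rfl fun i _ => by rw [map_smul, hw]
  exact funext (Fintype.linearIndependent_iff.mp b.linearIndependent c h3)

lemma finite_and_finrank_le_of_forall {L V : Type*} [Field L] [AddCommGroup V] [Module L V] {n : ℕ}
    (h : ∀ (m : ℕ) (w : Fin m → V), LinearIndependent L w → m ≤ n) :
    FiniteDimensional L V ∧ finrank L V ≤ n := by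
  have h1 : Module.rank L V ≤ n := rank_le fun s hs => by
    have := h _ _ (hs.comp s.equivFin.symm s.equivFin.symm.injective)
    simpa using this
  have h2 : FiniteDimensional L V := Module.rank_lt_aleph0_iff.mp
    (h1.trans_lt (Cardinal.natCast_lt_aleph0))
  exact ⟨h2, finrank_le_of_rank_le h1⟩

end LinearAlgebra

namespace PlaceFamily

open Polynomial IntermediateField

variable {K F X : Type*} [Field K] [Field F] [Algebra K F] {κ : X → Type*} [∀ x, Field (κ x)]
  [∀ x, Algebra K (κ x)] {P : ∀ x, DiscretePlace K F (κ x)}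

lemma aeval_mul_sum_mem {ι : Type*} [Fintype ι] {Q : OrderFunction K F} {t : F} {e : ℤ} (he : 0 ≤ e)
    (ht : t ∈ Q.filtration e) {r : ι → F} (hr : ∀ i, r i ∈ Q.filtration 0) {p : ι → K[X]}
    (h : ∑ i, aeval t (p i) * r i = 0) : ∑ i, (p i).coeff 0 • r i ∈ Q.filtration e := by
  have h1 : ∑ i, (p i).coeff 0 • r i = -∑ i, aeval t (p i).divX * t * r i := by
    rw [eq_neg_iff_add_eq_zero, ← h, ← Finset.sum_add_distrib]
    refine Finset.sum_congr rfl fun i _ => ?_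
    conv_rhs => rw [← divX_mul_X_add (p i)]
    simp [Algebra.smul_def]
    ring
  rw [h1]
  refine neg_mem (sum_mem fun i _ => ?_)
  have h2 := Q.mul_mem_filtration (Q.mul_mem_filtration
    (Q.mem_integers.mp (Q.aeval_mem_integers (Q.mem_integers.mpr (Q.filtration_anti he ht))
      (p i).divX)) ht) (hr i)
  simpa using h2

variable [∀ x, FiniteDimensional K (κ x)]

lemma sum_ord_mul_le_finrank {g : ℤ} (hP : IsGenus P g) {t : F} [FiniteDimensional K⟮t⟯ F]
    (S : Finset X) (hS : ∀ x ∈ S, 0 < (P x).ord t) :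
    ∑ x ∈ S, (P x).ord t * finrank K (κ x) ≤ finrank K⟮t⟯ F := by
  classical
  rcases S.eq_empty_or_nonempty with rfl | ⟨x₀, hx₀⟩
  · simp
  have ht0 : t ≠ 0 := (P x₀).ne_zero_of_ord_ne_zero (hS _ hx₀).ne'
  obtain ⟨D₀, hD₀⟩ := hP.exists_forall_ge
  let E : X →₀ ℤ := ∑ x ∈ S, Finsupp.single x ((P x).ord t)
  have hE : ∀ x, E x = if x ∈ S then (P x).ord t else 0 := by
    intro x
    simp [E, Finsupp.finsetSum_apply, Finsupp.single_apply]
  have hE0 : 0 ≤ E := by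
    intro x
    rw [hE]
    split_ifs with h
    · exact (hS x h).le
    · exact le_rfl
  have hdegE : deg K κ E = ∑ x ∈ S, (P x).ord t * finrank K (κ x) := by
    simp [E, map_sum, deg_single]
  let k : ℕ := ∑ x ∈ S, (D₀ x).toNat
  let D : X →₀ ℤ := D₀ ⊔ k • E
  have hDS : ∀ x ∈ S, D x = k * (P x).ord t := by
    intro x hx
    have h1 : (D₀ x).toNat ≤ k := Finset.single_le_sum (f := fun x => (D₀ x).toNat)
      (fun _ _ => Nat.zero_le _) hx
    have h2 : (k : ℤ) ≤ k * (P x).ord t := le_mul_of_one_le_right (by positivity) (hS x hx)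
    have h3 := Int.self_le_toNat (D₀ x)
    simp only [D, Finsupp.sup_apply, Finsupp.smul_apply, hE, if_pos hx, nsmul_eq_mul]
    exact sup_eq_right.mpr (by omega)
  have hD0D : D₀ ≤ D := le_sup_left
  have hDE : D ≤ D + E := le_add_of_nonneg_right hE0
  have hdiff : finrank K (space P (D + E)) - finrank K (space P D) = (deg K κ E).toNat := by
    have h1 := hD₀ D hD0D
    have h2 := hD₀ _ (hD0D.trans hDE)
    rw [map_add] at h2
    simp only [ell] at h1 h2
    omega
  have := hP.finite (D + E)
  obtain ⟨w, hw, hw'⟩ := exists_independent_modulo (space_mono P hDE)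
  have hind : LinearIndependent K⟮t⟯ (fun i => t ^ (k + 1) * w i) := by
    refine linearIndependent_adjoin_simple ht0 fun p hp => ?_
    have h1 : ∑ i, (p i).coeff 0 • w i ∈ space P D := by
      rw [mem_space]
      intro x
      by_cases hx : x ∈ S
      · have h2 : ∀ i, t ^ (k + 1) * w i ∈ (P x).filtration 0 := fun i => by
          have h3 := (P x).mul_mem_filtration (f := t ^ (k + 1))
            (Or.inr ((P x).ord_pow t (k + 1)).ge) ((mem_space P).mp (hw i) x)
          rw [Finsupp.add_apply, hDS x hx, hE, if_pos hx] at h3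
          convert h3 using 2
          push_cast
          ring
        have h3 := aeval_mul_sum_mem (hS x hx).le (Or.inr le_rfl) h2 hp
        simp_rw [← mul_smul_comm, ← Finset.mul_sum] at h3
        rw [hDS x hx, ← (P x).mul_mem_filtration_iff (pow_ne_zero (k + 1) ht0)
          ((P x).ord_pow t (k + 1))]
        convert h3 using 2
        push_cast
        ring
      · refine sum_mem fun i _ => Submodule.smul_mem _ _ ?_
        have := (mem_space P).mp (hw i) x
        rwa [Finsupp.add_apply, hE, if_neg hx, add_zero] at this
    exact fun i => congrFun (hw' _ h1) i
  have h4 := hind.fintype_card_le_finrank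
  rw [Fintype.card_fin, hdiff] at h4
  rw [← hdegE]
  omega

/-- Every function has only finitely many poles. -/
def FinitePoles (P : ∀ x, DiscretePlace K F (κ x)) : Prop := ∀ f : F, {x | (P x).ord f < 0}.Finite

open Classical in
/-- The divisor of poles of a function. -/
noncomputable def poleDivisor (hfin : FinitePoles P) (f : F) : X →₀ ℤ :=
  Finsupp.onFinset (hfin f).toFinset (fun x => max 0 (-(P x).ord f)) fun x hx => by
    rw [Set.Finite.mem_toFinset, Set.mem_ofPred]
    by_contra h
    exact hx (max_eq_left (by omega))

omit [∀ x, FiniteDimensional K (κ x)]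

lemma poleDivisor_apply (hfin : FinitePoles P) (f : F) (x : X) :
    poleDivisor hfin f x = max 0 (-(P x).ord f) := rfl

lemma poleDivisor_nonneg (hfin : FinitePoles P) (f : F) : 0 ≤ poleDivisor hfin f :=
  fun _ => le_max_left _ _

lemma mem_space_poleDivisor (hfin : FinitePoles P) (f : F) : f ∈ space P (poleDivisor hfin f) :=
  (mem_space P).mpr fun x => Or.inr (by rw [poleDivisor_apply, neg_le]; exact le_max_right _ _)

end PlaceFamily

open Module

lemma Transcendental.linearIndependent_powers {K L : Type*} [Field K] [Field L] [Algebra K L] {u : L}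
    (hu : Transcendental K u) : LinearIndependent K (fun n : ℕ => u ^ n) := by
  have h : (fun n : ℕ => u ^ n) =
      (Polynomial.aeval u).toLinearMap ∘ Polynomial.basisMonomials K := by
    ext n
    simp
  rw [h]
  exact (Polynomial.basisMonomials K).linearIndependent.map' (Polynomial.aeval u).toLinearMap
    (LinearMap.ker_eq_bot.mpr (transcendental_iff_injective.mp hu))

namespace PlaceFamily

open Polynomial IntermediateField

variable {K F X : Type*} [Field K] [Field F] [Algebra K F] {κ : X → Type*} [∀ x, Field (κ x)]
  [∀ x, Algebra K (κ x)] {P : ∀ x, DiscretePlace K F (κ x)} [∀ x, FiniteDimensional K (κ x)]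

lemma finite_and_finrank_adjoin_le {g : ℤ} (hP : IsGenus P g) (hfin : FinitePoles P) {D : X →₀ ℤ}
    (hD : 0 ≤ D) {u : F} (hu : Transcendental K u) (huD : u ∈ space P D) :
    FiniteDimensional K⟮u⟯ F ∧ finrank K⟮u⟯ F ≤ (deg K κ D).toNat := by
  refine finite_and_finrank_le_of_forall fun m w hw => ?_
  let A : X →₀ ℤ := ∑ i, poleDivisor hfin (w i)
  have hA : ∀ i, w i ∈ space P A := fun i => space_mono P
    (Finset.single_le_sum (f := fun i => poleDivisor hfin (w i))
      (fun i _ => poleDivisor_nonneg hfin _) (Finset.mem_univ i)) (mem_space_poleDivisor hfin _)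
  have hA0 : 0 ≤ A := Finset.sum_nonneg fun i _ => poleDivisor_nonneg hfin _
  have hdeg : 0 ≤ deg K κ D := by simpa using deg_mono (K := K) (κ := κ) hD
  have hgen : Transcendental K (AdjoinSimple.gen K u) := fun h =>
    hu (h.algHom (IntermediateField.val _))
  have key : ∀ N : ℕ, ((N + 1) * m : ℤ) ≤ N * deg K κ D + deg K κ A + ell P 0 := by
    intro N
    have h1 := linearIndependent_smul (hgen.linearIndependent_powers.comp
      (fun j : Fin (N + 1) => (j : ℕ)) Fin.val_injective) hw
    have h2 : ∀ p : Fin (N + 1) × Fin m, ((AdjoinSimple.gen K u) ^ (p.1 : ℕ)) • w p.2 ∈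
        space P (N • D + A) := by
      intro p
      have h3 : (p.1 : ℕ) • D ≤ N • D := nsmul_le_nsmul_left hD (Nat.lt_succ_iff.mp p.1.2)
      have h4 := mul_mem_space P (space_mono P h3 (pow_mem_space P huD p.1)) (hA p.2)
      exact h4
    have hfinD := hP.finite (N • D + A)
    have h3 : LinearIndependent K fun p : Fin (N + 1) × Fin m =>
        (⟨_, h2 p⟩ : space P (N • D + A)) :=
      LinearIndependent.of_comp (space P (N • D + A)).subtype h1
    have h4 := h3.fintype_card_le_finrank
    simp only [Fintype.card_prod, Fintype.card_fin] at h4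
    have h5 := (finite_and_ell_le P (add_nonneg (nsmul_nonneg hD N) hA0) (hP.finite 0)).2
    rw [sub_zero, map_add, map_nsmul, nsmul_eq_mul] at h5
    have h6 : ((N + 1) * m : ℤ) ≤ ell P (N • D + A) := mod_cast h4
    linarith
  by_contra! hlt
  have h1 : deg K κ D + 1 ≤ m := by omega
  set N := (deg K κ A + ell P 0).toNat
  have h2 := key N
  have h3 := Int.self_le_toNat (deg K κ A + ell P 0)
  have h4 : ((N : ℤ) + 1) * (deg K κ D + 1) ≤ (N + 1) * m :=
    mul_le_mul_of_nonneg_left h1 (by positivity)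
  linarith

omit [∀ x, FiniteDimensional K (κ x)] in
lemma adjoin_simple_inv (u : F) : K⟮u⁻¹⟯ = K⟮u⟯ :=
  le_antisymm (adjoin_simple_le_iff.mpr (inv_mem (mem_adjoin_simple_self K u)))
    (adjoin_simple_le_iff.mpr (by simpa using inv_mem (mem_adjoin_simple_self K u⁻¹)))

lemma finiteDimensional_adjoin {g : ℤ} (hP : IsGenus P g) (hfin : FinitePoles P) {u : F}
    (hu : Transcendental K u) : FiniteDimensional K⟮u⟯ F :=
  (finite_and_finrank_adjoin_le hP hfin (poleDivisor_nonneg hfin u) hu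
    (mem_space_poleDivisor hfin u)).1

/-- The degree of the divisor of poles of `u` is `[F : K(u)]`. -/
lemma deg_poleDivisor {g : ℤ} (hP : IsGenus P g) (hfin : FinitePoles P) {u : F}
    (hu : Transcendental K u) : deg K κ (poleDivisor hfin u) = finrank K⟮u⟯ F := by
  refine le_antisymm ?_ ?_
  · have := finiteDimensional_adjoin hP hfin hu
    rw [← adjoin_simple_inv] at this ⊢
    have h1 := sum_ord_mul_le_finrank hP (t := u⁻¹) (hfin u).toFinset (fun x hx => by
      simpa [OrderFunction.ord_inv] using hx)
    refine le_of_eq_of_le ?_ h1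
    classical
    have h2 : poleDivisor hfin u = ∑ x ∈ (hfin u).toFinset, Finsupp.single x ((P x).ord u⁻¹) := by
      ext x
      rw [Finsupp.finsetSum_apply, poleDivisor_apply]
      simp only [Finsupp.single_apply, Finset.sum_ite_eq', Set.Finite.mem_toFinset,
        Set.mem_ofPred, OrderFunction.ord_inv]
      split_ifs <;> omega
    rw [h2, map_sum]
    exact Finset.sum_congr rfl fun x _ => deg_single x _
  · have h1 := (finite_and_finrank_adjoin_le hP hfin (poleDivisor_nonneg hfin u) hu
      (mem_space_poleDivisor hfin u)).2
    have h2 : 0 ≤ deg K κ (poleDivisor hfin u) := by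
      simpa using deg_mono (K := K) (κ := κ) (poleDivisor_nonneg hfin u)
    omega

/-- The divisor of a function. -/
noncomputable def divisor (hfin : FinitePoles P) (f : F) : X →₀ ℤ :=
  poleDivisor hfin f⁻¹ - poleDivisor hfin f

omit [∀ x, FiniteDimensional K (κ x)] in
lemma divisor_apply (hfin : FinitePoles P) (f : F) (x : X) : divisor hfin f x = (P x).ord f := by
  rw [divisor, Finsupp.sub_apply, poleDivisor_apply, poleDivisor_apply, OrderFunction.ord_inv]
  omega

lemma deg_divisor {g : ℤ} (hP : IsGenus P g) (hfin : FinitePoles P) (f : F) :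
    deg K κ (divisor hfin f) = 0 := by
  by_cases hf : ∀ x, (P x).ord f = 0
  · rw [show divisor hfin f = 0 by ext x; simp [divisor_apply, hf], map_zero]
  push Not at hf
  obtain ⟨x, hx⟩ := hf
  have h1 := (P x).transcendental_of_ord_ne_zero hx
  have h2 : Transcendental K f⁻¹ := fun h => h1 (by simpa using h.inv)
  rw [divisor, map_sub, deg_poleDivisor hP hfin h1, deg_poleDivisor hP hfin h2, adjoin_simple_inv,
    sub_self]

omit [∀ x, FiniteDimensional K (κ x)] in
lemma ell_add_divisor (hfin : FinitePoles P) {f : F} (hf : f ≠ 0) (D : X →₀ ℤ) :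
    ell P (D + divisor hfin f) = ell P D := by
  have h1 : Function.Injective (LinearMap.mulLeft K f) := fun a b h => mul_left_cancel₀ hf h
  have h2 : (space P (D + divisor hfin f)).map (LinearMap.mulLeft K f) = space P D := by
    ext a
    have h3 : ∀ b, f * b ∈ space P D ↔ b ∈ space P (D + divisor hfin f) := by
      intro b
      rw [mem_space, mem_space]
      refine forall_congr' fun x => ?_
      rw [Finsupp.add_apply, divisor_apply, ← (P x).mul_mem_filtration_iff (f := b) hf rfl,
        show (P x).ord f + -(D x + (P x).ord f) = -D x by ring]
    refine ⟨?_, fun ha => ⟨f⁻¹ * a, (h3 _).mp ?_, ?_⟩⟩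
    · rintro ⟨b, hb, rfl⟩
      exact (h3 b).mpr hb
    · rwa [mul_inv_cancel_left₀ hf]
    · exact mul_inv_cancel_left₀ hf a
  rw [ell, ell, ← h2]
  exact ((space P (D + divisor hfin f)).equivMapOfInjective _ h1).finrank_eq

lemma exists_aeval_ord_ge {u : F} (hu : Transcendental K u) (D : X →₀ ℤ) :
    ∃ f : K[X], f ≠ 0 ∧ ∀ x, 0 ≤ (P x).ord u → D x ≤ (P x).ord (aeval u f) := by
  classical
  have h1 : ∀ x, ∃ f : K[X], f ≠ 0 ∧ (0 ≤ (P x).ord u → 1 ≤ (P x).ord (aeval u f)) := by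
    intro x
    by_cases hx : 0 ≤ (P x).ord u
    · set v : (P x).integers := ⟨u, Or.inr hx⟩
      obtain ⟨f, hf0, hf⟩ := Algebra.IsAlgebraic.isAlgebraic (R := K) ((P x).res v)
      refine ⟨f, hf0, fun _ => ?_⟩
      rw [aeval_algHom_apply, (P x).res_eq_zero_iff, Polynomial.aeval_subalgebra_coe] at hf
      exact hf.resolve_left fun h => hu ⟨f, hf0, h⟩
    · exact ⟨1, one_ne_zero, fun h => absurd h hx⟩
  choose f hf0 hf using h1
  have hne : ∀ {p : K[X]}, p ≠ 0 → aeval u p ≠ 0 := fun hp h => hu ⟨_, hp, h⟩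
  have h0 : ∀ x, 0 ≤ (P x).ord u → ∀ p : K[X], p ≠ 0 → 0 ≤ (P x).ord (aeval u p) := fun x hx p hp =>
    ((P x).aeval_mem_integers (f := u) (Or.inr hx) p).resolve_left (hne hp)
  refine ⟨∏ x ∈ D.support, f x ^ (D x).toNat, Finset.prod_ne_zero_iff.mpr fun x _ =>
    pow_ne_zero _ (hf0 x), fun x hx => ?_⟩
  by_cases hxD : x ∈ D.support
  · rw [← Finset.mul_prod_erase _ _ hxD, map_mul, (P x).ord_mul (hne (pow_ne_zero _ (hf0 x)))
      (hne (Finset.prod_ne_zero_iff.mpr fun x _ => pow_ne_zero _ (hf0 x))), map_pow,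
      (P x).ord_pow]
    have h2 := h0 x hx (∏ x ∈ D.support.erase x, f x ^ (D x).toNat)
      (Finset.prod_ne_zero_iff.mpr fun x _ => pow_ne_zero _ (hf0 x))
    have h3 : ((D x).toNat : ℤ) ≤ (D x).toNat * (P x).ord (aeval u (f x)) :=
      le_mul_of_one_le_right (by positivity) (hf x hx)
    have h4 := Int.self_le_toNat (D x)
    linarith
  · rw [Finsupp.notMem_support_iff.mp hxD]
    exact h0 x hx _ (Finset.prod_ne_zero_iff.mpr fun x _ => pow_ne_zero _ (hf0 x))

/-- The genus is computed by large multiples of a divisor of poles. -/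
lemma exists_forall_ell_eq {g : ℤ} (hP : IsGenus P g) (hfin : FinitePoles P) {u : F}
    (hu : Transcendental K u) {E : X →₀ ℤ} (hE : 0 ≤ E) :
    ∃ N₀ : ℕ, ∀ N ≥ N₀, (ell P (N • poleDivisor hfin u + E) : ℤ) =
      N * finrank K⟮u⟯ F + deg K κ E + 1 - g := by
  obtain ⟨D₀, hD₀⟩ := hP.exists_forall_ge
  obtain ⟨p, hp0, hp⟩ := exists_aeval_ord_ge (P := P) hu D₀
  set f := aeval u p
  have hf : f ≠ 0 := fun h => hu ⟨p, hp0, h⟩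
  refine ⟨∑ x ∈ (hfin u).toFinset, (D₀ x - (P x).ord f).toNat, fun N hN => ?_⟩
  have h1 : D₀ ≤ N • poleDivisor hfin u + E + divisor hfin f := by
    intro x
    have hEx := hE x
    rw [Finsupp.add_apply, Finsupp.add_apply, Finsupp.smul_apply, divisor_apply, nsmul_eq_mul,
      poleDivisor_apply]
    rw [Finsupp.zero_apply] at hEx
    rcases le_or_gt 0 ((P x).ord u) with hx | hx
    · rw [max_eq_left (by omega), mul_zero]
      have := hp x hx
      omega
    · rw [max_eq_right (by omega)]
      have h2 : (D₀ x - (P x).ord f).toNat ≤ N := (Finset.single_le_sum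
        (f := fun x => (D₀ x - (P x).ord f).toNat) (fun _ _ => Nat.zero_le _)
        ((hfin u).mem_toFinset.mpr hx)).trans hN
      have h3 := Int.self_le_toNat (D₀ x - (P x).ord f)
      have h4 : (N : ℤ) ≤ N * -(P x).ord u := le_mul_of_one_le_right (by positivity) (by omega)
      omega
  have h2 := hD₀ _ h1
  rwa [ell_add_divisor hfin hf, map_add, deg_divisor hP, add_zero, map_add, map_nsmul,
    deg_poleDivisor hP hfin hu, nsmul_eq_mul] at h2

end PlaceFamily

open Module

namespace PlaceFamily

open IntermediateField

variable {K F X : Type*} [Field K] [Field F] [Algebra K F] {κ : X → Type*} [∀ x, Field (κ x)]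
  [∀ x, Algebra K (κ x)] {P : ∀ x, DiscretePlace K F (κ x)} [∀ x, FiniteDimensional K (κ x)]

variable {F' X' : Type*} [Field F'] [Algebra K F'] {κ' : X' → Type*} [∀ x, Field (κ' x)]
  [∀ x, Algebra K (κ' x)] {P' : ∀ x, DiscretePlace K F' (κ' x)}
  [∀ x, FiniteDimensional K (κ' x)] [Algebra F' F]

/-- Every place in the family `P` of `F` lies above a place in the family `P'` of `F'`, or is
trivial on `F'`. -/
def LiesAbove (P : ∀ x, DiscretePlace K F (κ x)) (P' : ∀ x, DiscretePlace K F' (κ' x)) : Prop :=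
  ∀ x, (∃ y, ∀ f : F', 0 ≤ (P' y).ord f → 0 ≤ (P x).ord (algebraMap F' F f)) ∨
    ∀ f : F', 0 ≤ (P x).ord (algebraMap F' F f)

omit [∀ x, FiniteDimensional K (κ x)] [∀ x, FiniteDimensional K (κ' x)] in
lemma LiesAbove.map_mem_space (h : LiesAbove P P') (hfin : FinitePoles P) (hfin' : FinitePoles P')
    {u f : F'} {N : ℕ} (hf : f ∈ space P' (N • poleDivisor hfin' u)) :
    algebraMap F' F f ∈ space P (N • poleDivisor hfin (algebraMap F' F u)) := by
  rw [mem_space] at *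
  intro x
  by_cases hf0 : f = 0
  · simp [hf0]
  refine Or.inr ?_
  rw [Finsupp.smul_apply, poleDivisor_apply, nsmul_eq_mul]
  have h0 : 0 ≤ (N : ℤ) * max 0 (-(P x).ord (algebraMap F' F u)) := by positivity
  rcases h x with ⟨y, hy⟩ | hx
  · have h1 := hf y
    rw [OrderFunction.mem_filtration_of_ne_zero _ hf0, Finsupp.smul_apply, poleDivisor_apply,
      nsmul_eq_mul] at h1
    rcases le_or_gt 0 ((P' y).ord u) with hu | hu
    · rw [max_eq_left (by omega), mul_zero, neg_zero] at h1
      have := hy f h1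
      omega
    · rw [max_eq_right (by omega)] at h1
      have hu0 : u ≠ 0 := (P' y).ne_zero_of_ord_ne_zero hu.ne
      have h2 := hy u⁻¹ (by rw [OrderFunction.ord_inv]; omega)
      have h3 := hy (f * (u⁻¹) ^ N) (by
        rw [OrderFunction.ord_mul _ hf0 (pow_ne_zero _ (inv_ne_zero hu0)), OrderFunction.ord_pow,
          OrderFunction.ord_inv]
        linarith)
      rw [map_inv₀, OrderFunction.ord_inv] at h2
      rw [map_mul, map_pow, map_inv₀, OrderFunction.ord_mul _ (by simpa using hf0)
        (by simp [hu0]), OrderFunction.ord_pow, OrderFunction.ord_inv] at h3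
      rw [max_eq_right h2]
      linarith
  · have := hx f
    omega

variable [IsScalarTower K F' F]

lemma finrank_adjoin_algebraMap (u : F') :
    finrank K⟮algebraMap F' F u⟯ F = finrank K⟮u⟯ F' * finrank F' F := by
  rw [finrank_mul_finrank]
  let φ := IsScalarTower.toAlgHom K F' F
  have h : K⟮u⟯.map φ = K⟮algebraMap F' F u⟯ := by
    rw [adjoin_map, Set.image_singleton]
    rfl
  refine (Algebra.finrank_eq_of_equiv_equiv
    ((K⟮u⟯.equivMap φ).trans (equivOfEq h)).toRingEquiv (RingEquiv.refl F) ?_).symm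
  ext x
  rfl

/-- The Castelnuovo–Severi inequality for a function field `F = F'(h)`. -/
theorem castelnuovo_severi {g g' : ℤ} (hP : IsGenus P g) (hfin : FinitePoles P)
    (hP' : IsGenus P' g') (hfin' : FinitePoles P') (hPP' : LiesAbove P P')
    [FiniteDimensional F' F] {u : F'} (hu : Transcendental K u) {h : F} (hh : F'⟮h⟯ = ⊤)
    {D : X →₀ ℤ} (hD : 0 ≤ D) (hhD : h ∈ space P D) :
    g ≤ finrank F' F * g' + (finrank F' F - 1) * (deg K κ D - 1) := by
  set m := finrank F' F with hm
  have hm1 : 1 ≤ m := finrank_pos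
  have hu' : Transcendental K (algebraMap F' F u) := by
    rwa [transcendental_algebraMap_iff (algebraMap F' F).injective]
  obtain ⟨N₁, hN₁⟩ := exists_forall_ell_eq hP hfin hu' (nsmul_nonneg hD (m - 1))
  obtain ⟨N₂, hN₂⟩ := exists_forall_ell_eq hP' hfin' hu (le_refl 0)
  set N := max N₁ N₂
  have h1 := hN₁ N (le_max_left _ _)
  have h2 := hN₂ N (le_max_right _ _)
  rw [map_zero, add_zero, add_zero] at h2
  have h3 : finrank K⟮algebraMap F' F u⟯ F = finrank K⟮u⟯ F' * m := finrank_adjoin_algebraMap u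
  have hdeg : (minpoly F' h).natDegree = m := by
    rw [← adjoin.finrank (Algebra.IsIntegral.isIntegral h), hh, finrank_top']
  have hfinD := hP'.finite (N • poleDivisor hfin' u)
  have hfinE := hP.finite (N • poleDivisor hfin (algebraMap F' F u) + (m - 1) • D)
  let b := finBasis K (space P' (N • poleDivisor hfin' u))
  have h4 := linearIndependent_smul (b.linearIndependent.map' (Submodule.subtype _)
    (Submodule.ker_subtype _)) (linearIndependent_pow (K := F') h)
  have h5 : ∀ p : Fin (ell P' (N • poleDivisor hfin' u)) × Fin (minpoly F' h).natDegree,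
      (b p.1 : F') • h ^ (p.2 : ℕ) ∈
        space P (N • poleDivisor hfin (algebraMap F' F u) + (m - 1) • D) := fun p => by
    rw [Algebra.smul_def]
    refine mul_mem_space P (hPP'.map_mem_space hfin hfin' (b p.1).2) ?_
    exact space_mono P (nsmul_le_nsmul_left hD (by have := p.2.2; omega)) (pow_mem_space P hhD _)
  have h6 : LinearIndependent K fun p => (⟨_, h5 p⟩ :
      space P (N • poleDivisor hfin (algebraMap F' F u) + (m - 1) • D)) :=
    LinearIndependent.of_comp (Submodule.subtype _) h4
  have h7 := h6.fintype_card_le_finrank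
  simp only [Fintype.card_prod, Fintype.card_fin, hdeg] at h7
  have h8 : (ell P' (N • poleDivisor hfin' u) : ℤ) * m ≤
    ell P (N • poleDivisor hfin (algebraMap F' F u) + (m - 1) • D) := mod_cast h7
  rw [h1, h2, h3, map_nsmul, nsmul_eq_mul] at h8
  push_cast [Nat.cast_sub hm1] at h8
  linarith

omit [Algebra F' F] [IsScalarTower K F' F] [∀ x, FiniteDimensional K (κ' x)] in
lemma exists_adjoin_simple_eq_top {h : F} (hh : Transcendental K h) (φ : F' →ₐ[K] K⟮h⟯) :
    ∃ v : F', K⟮v⟯ = ⊤ := by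
  let ψ : F' →ₐ[K] RatFunc K := ((RatFunc.algEquivOfTranscendental h hh).symm : _ →ₐ[K] _).comp φ
  have h1 := RatFunc.Luroth.eq_adjoin_generator (E := ψ.fieldRange)
  obtain ⟨v, hv⟩ : RatFunc.Luroth.generator ψ.fieldRange ∈ ψ.fieldRange :=
    h1.ge (mem_adjoin_simple_self K (RatFunc.Luroth.generator ψ.fieldRange))
  refine ⟨v, map_injective ψ ?_⟩
  rw [adjoin_map, Set.image_singleton]
  have hv' : ψ v = RatFunc.Luroth.generator ψ.fieldRange := hv
  rw [hv', ← h1, ← AlgHom.fieldRange_eq_map]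

lemma genus_nonpos_of_adjoin_simple_eq_top {g : ℤ} (hP : IsGenus P g) (hfin : FinitePoles P)
    {v : F} (hv : Transcendental K v) (htop : K⟮v⟯ = ⊤) : g ≤ 0 := by
  obtain ⟨N, hN⟩ := exists_forall_ell_eq hP hfin hv (le_refl 0)
  have h1 := hN N le_rfl
  rw [htop, IntermediateField.finrank_top, map_zero, add_zero, add_zero] at h1
  have hfinD := hP.finite (N • poleDivisor hfin v)
  have h2 : ∀ i : Fin (N + 1), v ^ (i : ℕ) ∈ space P (N • poleDivisor hfin v) := fun i =>
    space_mono P (nsmul_le_nsmul_left (poleDivisor_nonneg hfin v) (Nat.lt_succ_iff.mp i.2))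
      (pow_mem_space P (mem_space_poleDivisor hfin v) _)
  have h3 : LinearIndependent K fun i => (⟨_, h2 i⟩ : space P (N • poleDivisor hfin v)) :=
    LinearIndependent.of_comp (Submodule.subtype _)
      (hv.linearIndependent_powers.comp _ Fin.val_injective)
  have h4 := h3.fintype_card_le_finrank
  rw [Fintype.card_fin] at h4
  have h5 : (N + 1 : ℤ) ≤ ell P (N • poleDivisor hfin v) := mod_cast h4
  push_cast at h1
  linarith

end PlaceFamily

open Module

namespace PlaceFamily

open IntermediateField

/-- If `h` has a simple pole at a place with primitive residue field, and `[F : K(h)]` is the degree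
of the place, then there is no field strictly between `K(h)` and `F`. -/
lemma eq_top_or_eq_adjoin {K F κ : Type*} [Field K] [Field F] [Field κ] [Algebra K F] [Algebra K κ]
    [FiniteDimensional K κ] (Q : DiscretePlace K F κ) {h : F} (hh : Q.ord h = -1)
    [FiniteDimensional K⟮h⟯ F] (hdeg : finrank K⟮h⟯ F = finrank K κ)
    (hprim : ∀ L : IntermediateField K κ, L = ⊥ ∨ L = ⊤) {E : IntermediateField K F}
    (hE : K⟮h⟯ ≤ E) : E = ⊤ ∨ E = K⟮h⟯ := by
  classical
  obtain ⟨t, rfl⟩ : ∃ t, h = t⁻¹ := ⟨h⁻¹, (inv_inv h).symm⟩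
  rw [OrderFunction.ord_inv, neg_inj] at hh
  have ht0 : t ≠ 0 := Q.ne_zero_of_ord_ne_zero (by omega)
  rw [adjoin_simple_inv] at *
  have htE : t ∈ E := hE (mem_adjoin_simple_self K t)
  let b := finBasis K κ
  let R : Subalgebra K κ := (E.toSubalgebra.comap Q.integers.val).map Q.res
  have hR : ∀ x : Q.integers, (x : F) ∈ E → Q.res x ∈ R := fun x hx => ⟨x, hx, rfl⟩
  rcases hprim (subalgebraEquivIntermediateField R) with hL | hL
  · right
    have hR' : ∀ x : Q.integers, (x : F) ∈ E → ∃ c : K, algebraMap K κ c = Q.res x := by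
      intro x hx
      rw [← Set.mem_range, ← IntermediateField.mem_bot, ← hL, mem_subalgebraEquivIntermediateField]
      exact hR x hx
    choose w hw using fun i => Q.res_surjective (b i)
    have hind : LinearIndependent E fun i => (w i : F) := by
      rw [Fintype.linearIndependent_iff]
      intro c hc
      by_contra! hne
      have hne' : (Finset.univ.filter fun i => c i ≠ 0).Nonempty := by
        obtain ⟨i, hi⟩ := hne
        exact ⟨i, by simpa using hi⟩
      obtain ⟨j, hj, hmin⟩ := Finset.exists_min_image _ (fun i => Q.ord (c i : F)) hne'
      simp only [Finset.mem_filter, Finset.mem_univ, true_and] at hj hmin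
      set n := Q.ord (c j : F)
      have hd : ∀ i, t ^ (-n) * (c i : F) ∈ Q.integers := by
        intro i
        by_cases hi : c i = 0
        · simp [hi]
        · have := Q.mul_mem_filtration (f := t ^ (-n)) (Or.inr le_rfl) (Or.inr (hmin i hi))
          rwa [Q.ord_zpow, hh, mul_one, neg_add_cancel] at this
      choose k hk using fun i => hR' ⟨_, hd i⟩ (mul_mem (zpow_mem htE _) (c i).2)
      have hsum : ∑ i, (⟨_, hd i⟩ : Q.integers) * w i = 0 := by
        apply Subtype.ext
        rw [AddSubmonoidClass.coe_finsetSum]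
        simp only [MulMemClass.coe_mul, mul_assoc, ← Finset.mul_sum]
        rw [show ∑ i, (c i : F) * (w i : F) = 0 from hc, mul_zero]
        rfl
      have h1 : ∑ i, k i • b i = 0 := by
        rw [← map_zero Q.res, ← hsum, map_sum]
        exact Finset.sum_congr rfl fun i _ => by rw [map_mul, hw, ← hk, Algebra.smul_def]
      have h2 := Fintype.linearIndependent_iff.mp b.linearIndependent k h1 j
      have h3 := hk j
      rw [h2, map_zero, eq_comm, Q.res_eq_zero_iff] at h3
      have hcj : (c j : F) ≠ 0 := by simpa using hj
      have h4 : t ^ (-n) * (c j : F) ≠ 0 := mul_ne_zero (zpow_ne_zero _ ht0) hcj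
      rw [Q.mem_filtration_of_ne_zero h4, Q.ord_mul (zpow_ne_zero _ ht0) hcj, Q.ord_zpow, hh] at h3
      omega
    have h1 := relfinrank_mul_finrank_top hE
    have hpos : 0 < finrank K κ := finrank_pos
    have hEF : FiniteDimensional E F := Module.finite_of_finrank_pos
      (Nat.pos_of_mul_pos_left (by rw [h1, hdeg]; exact hpos))
    have h2 := hind.fintype_card_le_finrank
    rw [Fintype.card_fin, ← hdeg, ← h1] at h2
    have h3 : 0 < finrank E F := finrank_pos
    have h4 : relfinrank K⟮t⟯ E ≤ 1 := by
      by_contra! hlt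
      nlinarith
    have h5 : relfinrank K⟮t⟯ E ≠ 0 := by
      intro h0
      rw [h0, zero_mul, hdeg] at h1
      omega
    exact le_antisymm (relfinrank_eq_one_iff.mp (by omega)) hE
  · left
    have hR' : ∀ y, ∃ x : Q.integers, (x : F) ∈ E ∧ Q.res x = y := by
      intro y
      have : y ∈ subalgebraEquivIntermediateField R := hL ▸ IntermediateField.mem_top
      obtain ⟨x, hx, hxy⟩ := (mem_subalgebraEquivIntermediateField).mp this
      exact ⟨x, hx, hxy⟩
    choose w hwE hw using fun i => hR' (b i)
    have hind : LinearIndependent K⟮t⟯ fun i => (w i : F) := by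
      refine linearIndependent_adjoin_simple ht0 fun p hp => ?_
      have h1 := aeval_mul_sum_mem (Q := Q.toOrderFunction) zero_le_one (Or.inr hh.ge)
        (fun i => (w i).2) hp
      have h2 : ∑ i, (p i).coeff 0 • b i = 0 := by
        have h3 : Q.res (∑ i, (p i).coeff 0 • w i) = 0 := by
          rw [Q.res_eq_zero_iff, AddSubmonoidClass.coe_finsetSum]
          exact h1
        rw [← h3, map_sum]
        exact Finset.sum_congr rfl fun i _ => by rw [map_smul, hw]
      exact Fintype.linearIndependent_iff.mp b.linearIndependent _ h2
    have h1 := hind.span_eq_top_of_card_eq_finrank' (by rw [Fintype.card_fin, hdeg])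
    have h2 : (⊤ : Submodule K⟮t⟯ F) ≤ Subalgebra.toSubmodule (extendScalars hE).toSubalgebra := by
      rw [← h1, Submodule.span_le]
      rintro _ ⟨i, rfl⟩
      exact hwE i
    exact eq_top_iff.mpr fun x _ => h2 (Submodule.mem_top (x := x))

variable {K F X : Type*} [Field K] [Field F] [Algebra K F] {κ : X → Type*} [∀ x, Field (κ x)]
  [∀ x, Algebra K (κ x)] {P : ∀ x, DiscretePlace K F (κ x)} [∀ x, FiniteDimensional K (κ x)]

variable {F' X' : Type*} [Field F'] [Algebra K F'] {κ' : X' → Type*} [∀ x, Field (κ' x)]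
  [∀ x, Algebra K (κ' x)] {P' : ∀ x, DiscretePlace K F' (κ' x)}
  [∀ x, FiniteDimensional K (κ' x)] [Algebra F' F] [IsScalarTower K F' F]

lemma finiteDimensional_of_transcendental {g : ℤ} (hP : IsGenus P g) (hfin : FinitePoles P)
    {u : F'} (hu : Transcendental K u) : FiniteDimensional F' F := by
  have hu' : Transcendental K (algebraMap F' F u) := by
    rwa [transcendental_algebraMap_iff (algebraMap F' F).injective]
  have := finiteDimensional_adjoin hP hfin hu'
  have h1 : finrank K⟮algebraMap F' F u⟯ F = finrank K⟮u⟯ F' * finrank F' F :=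
    finrank_adjoin_algebraMap u
  have h2 : 0 < finrank K⟮algebraMap F' F u⟯ F := finrank_pos
  rw [h1] at h2
  exact Module.finite_of_finrank_pos (Nat.pos_of_mul_pos_left h2)

/-- A function whose only pole is a simple pole at a place of degree `d` generates `F` over
`F'`, or generates a field containing `F'`. -/
theorem not_lt_genus {g g' : ℤ} (hP : IsGenus P g) (hfin : FinitePoles P)
    (hP' : IsGenus P' g') (hfin' : FinitePoles P') (hPP' : LiesAbove P P') (hg' : 1 ≤ g')
    {u : F'} (hu : Transcendental K u) {q : X} {h : F} (hh : Transcendental K h)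
    (hhD : h ∈ space P (Finsupp.single q 1))
    (hprim : (∀ L : IntermediateField K (κ q), L = ⊥ ∨ L = ⊤) ∨
      Nat.gcd (finrank K (κ q)) (finrank F' F) = 1) :
    g ≤ finrank F' F * g' + (finrank F' F - 1) * (finrank K (κ q) - 1) := by
  have hFF' : FiniteDimensional F' F := finiteDimensional_of_transcendental hP hfin hu
  have hFh := finiteDimensional_adjoin hP hfin hh
  have hle : ∀ x, -(Finsupp.single q 1 : X →₀ ℤ) x ≤ (P x).ord h := fun x =>
    ((mem_space P).mp hhD x).resolve_left fun h0 => hh (h0 ▸ isAlgebraic_zero)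
  have hnonneg : ∀ x, x ≠ q → 0 ≤ (P x).ord h := fun x hx => by
    simpa [Finsupp.single_eq_of_ne hx] using hle x
  have hdeg0 := deg_poleDivisor hP hfin hh
  have hq : (P q).ord h = -1 := by
    have h1 := hle q
    rw [Finsupp.single_eq_same] at h1
    by_contra hne
    have h2 : poleDivisor hfin h = 0 := by
      ext x
      rw [poleDivisor_apply, Finsupp.zero_apply]
      rcases eq_or_ne x q with rfl | hx
      · exact max_eq_left (by omega)
      · exact max_eq_left (by linarith [hnonneg x hx])
    have h3 : 0 < finrank K⟮h⟯ F := finrank_pos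
    rw [h2, map_zero] at hdeg0
    omega
  have hpole : poleDivisor hfin h = Finsupp.single q 1 := by
    ext x
    rw [poleDivisor_apply]
    rcases eq_or_ne x q with rfl | hx
    · simp [hq]
    · rw [Finsupp.single_eq_of_ne hx]
      exact max_eq_left (by linarith [hnonneg x hx])
  have hdeg : finrank K⟮h⟯ F = finrank K (κ q) := by
    rw [hpole, deg_single, one_mul] at hdeg0
    exact_mod_cast hdeg0.symm
  set E : IntermediateField K F := F'⟮h⟯.restrictScalars K
  have hhE : h ∈ E := mem_adjoin_simple_self F' h
  have hE : K⟮h⟯ ≤ E := adjoin_simple_le_iff.mpr hhE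
  have hcases : E = ⊤ ∨ E = K⟮h⟯ := by
    rcases hprim with hprim | hgcd
    · exact eq_top_or_eq_adjoin (P q) hq hdeg hprim hE
    · left
      have h1 : finrank E F ∣ finrank K (κ q) := by
        rw [← hdeg, ← relfinrank_mul_finrank_top hE]
        exact dvd_mul_left _ _
      have h2 : finrank E F ∣ finrank F' F :=
        ⟨finrank F' F'⟮h⟯, by rw [mul_comm]; exact (finrank_mul_finrank F' F'⟮h⟯ F).symm⟩
      have h3 := Nat.dvd_gcd h1 h2
      rw [hgcd, Nat.dvd_one] at h3
      exact IntermediateField.finrank_eq_one_iff_eq_top.mp h3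
  rcases hcases with hE' | hE'
  · have htop : F'⟮h⟯ = ⊤ := restrictScalars_injective K (by rw [restrictScalars_top]; exact hE')
    have := castelnuovo_severi hP hfin hP' hfin' hPP' hu htop
      (D := Finsupp.single q 1) (by simp [Finsupp.single_nonneg]) hhD
    rwa [deg_single, one_mul] at this
  · exfalso
    have hmem : ∀ f : F', algebraMap F' F f ∈ K⟮h⟯ := fun f => hE' ▸ F'⟮h⟯.algebraMap_mem f
    let φ : F' →ₐ[K] K⟮h⟯ := (IsScalarTower.toAlgHom K F' F).codRestrict K⟮h⟯.toSubalgebra hmem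
    obtain ⟨v, hv⟩ := exists_adjoin_simple_eq_top hh φ
    have hv' : Transcendental K v := by
      intro halg
      have h1 := isAlgebraic_adjoin_simple (K := K) halg.isIntegral
      have h2 : Algebra.IsAlgebraic K (⊤ : IntermediateField K F') := hv ▸ h1
      exact hu ((h2.isAlgebraic ⟨u, IntermediateField.mem_top⟩).algHom (IntermediateField.val _))
    have := genus_nonpos_of_adjoin_simple_eq_top hP' hfin' hv' hv
    omega

end PlaceFamily

/-- The local rings of a standard smooth domain of relative dimension one over a field have
principal maximal ideals. -/
lemma isPrincipal_maximalIdeal_of_isStandardSmooth {k S A : Type*} [CommRing k] [CommRing S]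
    [CommRing A] [Algebra S A] [IsLocalRing A] (hk : IsField k) {f : k →+* S}
    (hf : f.IsStandardSmoothOfRelativeDimension 1) (q : Ideal S) [q.IsPrime]
    [IsLocalization.AtPrime A q] : (IsLocalRing.maximalIdeal A).IsPrincipal := by
  let := hk.toField
  obtain ⟨g, -, hg⟩ := hf.exists_etale_mvPolynomial
  let R := MvPolynomial (Fin 1) k
  have hR : IsPrincipalIdealRing R := IsPrincipalIdealRing.of_surjective
    (MvPolynomial.uniqueAlgEquiv k (Fin 1)).symm.toRingEquiv
    (MvPolynomial.uniqueAlgEquiv k (Fin 1)).symm.surjective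
  algebraize [g]
  let p := q.under R
  let := Localization.AtPrime.algebraOfLiesOver p q
  have h1 := ((Algebra.isUnramifiedAt_iff_map_eq R p q).mp inferInstance).2
  obtain ⟨a, ha⟩ := (IsPrincipalIdealRing.principal p).principal
  have h2 : IsLocalRing.maximalIdeal (Localization.AtPrime q) =
      Ideal.span {algebraMap R (Localization.AtPrime q) a} := by
    rw [← h1, ha]
    rw [Ideal.map_span, Set.image_singleton]
  let e := IsLocalization.algEquiv q.primeCompl (Localization.AtPrime q) A
  have h3 : (IsLocalRing.maximalIdeal (Localization.AtPrime q)).map e.toRingEquiv.toRingHom =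
      IsLocalRing.maximalIdeal A := IsLocalRing.map_ringEquiv_maximalIdeal e.toRingEquiv
  rw [← h3, h2, Ideal.map_span, Set.image_singleton]
  exact ⟨_, rfl⟩

namespace Curve

variable {K : Type u} [Field K] (C : Curve K)

lemma isPrincipal_maximalIdeal_stalk (x : C.X) :
    (IsLocalRing.maximalIdeal (C.X.presheaf.stalk x)).IsPrincipal := by
  obtain ⟨U, hU, V, hV, hx, e, hf⟩ := C.smooth.exists_isStandardSmoothOfRelativeDimension x
  have hUtop : U = ⊤ := by
    ext y
    simpa [Subsingleton.elim y (C.f x)] using e hx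
  subst hUtop
  let := (C.X.presheaf.germ V x hx).hom.toAlgebra
  have := hV.isLocalization_stalk ⟨x, hx⟩
  exact isPrincipal_maximalIdeal_of_isStandardSmooth
    (isField_of_isIntegral_of_subsingleton _) hf (hV.primeIdealOf ⟨x, hx⟩).asIdeal

lemma coheight_genericPoint : Order.coheight (genericPoint C.X) = 0 :=
  Order.coheight_eq_zero.mpr fun y _ => genericPoint_specializes y

lemma ringKrullDim_stalk_le (x : C.X) : ringKrullDim (C.X.presheaf.stalk x) ≤ 1 := by
  by_cases hx : IsField (C.X.presheaf.stalk x)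
  · rw [ringKrullDim_eq_zero_of_isField hx]
    exact zero_le_one
  · have : IsDiscreteValuationRing (C.X.presheaf.stalk x) :=
      ((IsDiscreteValuationRing.TFAE _ hx).out 4 0).mp (C.isPrincipal_maximalIdeal_stalk x)
    exact (IsDiscreteValuationRing.ringKrullDim_eq_one _).le

lemma coheight_eq_one {x : C.X} (hx : x ≠ genericPoint C.X) : Order.coheight x = 1 := by
  have h1 := C.ringKrullDim_stalk_le x
  rw [ringKrullDim_stalk_eq_coheight] at h1
  refine le_antisymm (by exact_mod_cast h1) (Order.one_le_iff_ne_zero.mpr fun h0 => hx ?_)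
  have h2 := Order.coheight_eq_zero.mp h0
  have h3 : x ≤ genericPoint C.X := genericPoint_specializes x
  exact (Specializes.antisymm (h3 : genericPoint C.X ⤳ x) (h2 h3)).eq.symm

variable {C}

lemma ClosedPoint.ne_genericPoint (x : C.ClosedPoint) : x.1 ≠ genericPoint C.X := by
  intro h
  have := x.2
  rw [h, C.coheight_genericPoint] at this
  exact zero_ne_one this

instance (x : C.ClosedPoint) : IsDiscreteValuationRing (C.X.presheaf.stalk x.1) := by
  refine ((IsDiscreteValuationRing.TFAE _ fun h => ?_).out 4 0).mp
    (C.isPrincipal_maximalIdeal_stalk x.1)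
  have h1 := ringKrullDim_stalk_eq_coheight x.1
  rw [x.2, ringKrullDim_eq_zero_of_isField h] at h1
  exact absurd h1 (by decide)

lemma ClosedPoint.isClosed (x : C.ClosedPoint) : IsClosed {x.1} := by
  rw [← closure_eq_iff_isClosed]
  refine le_antisymm (fun y hy => ?_) subset_closure
  have hxy : x.1 ⤳ y := specializes_iff_mem_closure.mpr hy
  by_contra hne
  have hlt : y < x.1 := lt_of_le_not_ge hxy fun h => hne (Specializes.antisymm (h : y ⤳ x.1) hxy).eq
  have hy1 : y ≠ genericPoint C.X := fun h => hne
    (hxy.antisymm (h ▸ genericPoint_specializes x.1)).eq.symm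
  have := Order.coheight_add_one_le hlt
  rw [x.2, C.coheight_eq_one hy1] at this
  exact absurd this (by decide)

/-- The embedding of the base field in a residue field. -/
noncomputable def residueConstants (C : Curve K) (x : C.X) : .of K ⟶ C.X.residueField x :=
  Spec.preimage (C.X.fromSpecResidueField x ≫ C.f)

lemma SpecMap_residueConstants (x : C.X) :
    Spec.map (C.residueConstants x) = C.X.fromSpecResidueField x ≫ C.f := Spec.map_preimage _

noncomputable instance (x : C.X) : Algebra K (C.X.residueField x) :=
  (C.residueConstants x).hom.toAlgebra

instance (x : C.ClosedPoint) : Module.Finite K (C.X.residueField x.1) := by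
  have h : IsFinite (C.X.fromSpecResidueField x.1 ≫ C.f) := by
    have := isClosed_singleton_iff_isClosedImmersion.mp x.isClosed
    rw [isFinite_iff_locallyOfFiniteType_of_jacobsonSpace]
    infer_instance
  rw [← SpecMap_residueConstants, IsFinite.SpecMap_iff] at h
  exact h

lemma residueDegree_eq (x : C.X) :
    C.f.residueDegree x = Module.finrank K (C.X.residueField x) := by
  have h1 := C.f.SpecMap_residueFieldMap_fromSpecResidueField x
  let φ : .of K ⟶ (Spec (.of K)).residueField (C.f x) :=
    Spec.preimage ((Spec (.of K)).fromSpecResidueField (C.f x))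
  have hφ : Spec.map φ = (Spec (.of K)).fromSpecResidueField (C.f x) := Spec.map_preimage _
  have h2 : φ ≫ C.f.residueFieldMap x = C.residueConstants x := by
    apply Spec.map_injective
    rw [Spec.map_comp, hφ, h1, SpecMap_residueConstants]
  have h3 : Function.Bijective φ.hom := by
    refine ⟨φ.hom.injective, ?_⟩
    have h4 : IsClosed {C.f x} := by
      rw [Set.subsingleton_of_subsingleton.eq_singleton_of_mem (Set.mem_singleton (C.f x))]
      exact (Set.finite_singleton _).isClosed
    rw [isClosed_singleton_iff_isClosedImmersion, ← hφ] at h4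
    exact ((HasAffineProperty.SpecMap_iff_of_affineAnd IsClosedImmersion.hasAffineProperty
      RingHom.surjective_respectsIso _).mp h4)
  let := (C.f.residueFieldMap x).hom.toAlgebra
  refine (Algebra.finrank_eq_of_equiv_equiv (RingEquiv.ofBijective φ.hom h3)
    (RingEquiv.refl (C.X.residueField x)) ?_).symm
  exact (congrArg CommRingCat.Hom.hom h2 :)

end Curve

namespace Curve

variable {K : Type u} [Field K] (C : Curve K)

/-- The embedding of the base field in a local ring. -/
noncomputable def stalkConstants (x : C.X) : .of K ⟶ C.X.presheaf.stalk x :=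
  (Scheme.ΓSpecIso (.of K)).inv ≫ C.f.appTop ≫ C.X.presheaf.germ ⊤ x trivial

variable {C}

lemma SpecMap_stalkConstants (x : C.X) :
    Spec.map (C.stalkConstants x) = C.X.fromSpecStalk x ≫ C.f := by
  rw [stalkConstants, Spec.map_comp, Spec.map_comp, ← Scheme.fromSpecStalk_toSpecΓ,
    Category.assoc, Category.assoc, ← Scheme.toSpecΓ_naturality_assoc, ← SpecMap_ΓSpecIso_hom,
    ← Spec.map_comp]
  simp

lemma stalkConstants_residue (x : C.X) :
    C.stalkConstants x ≫ C.X.residue x = C.residueConstants x := by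
  apply Spec.map_injective
  rw [Spec.map_comp, SpecMap_stalkConstants, SpecMap_residueConstants]
  rfl

lemma algebraMap_stalkConstants (x : C.X) (c : K) :
    algebraMap (C.X.presheaf.stalk x) C.X.functionField (C.stalkConstants x c) =
      algebraMap K C.X.functionField c := by
  have : Nonempty (⊤ : C.X.Opens) := ⟨⟨genericPoint C.X, trivial⟩⟩
  exact Scheme.algebraMap_germ_eq_germToFunctionField _ (U := ⊤) (x := x) trivial _

lemma germToFunctionField_appLE (C : Curve K) {V : C.X.Opens} [Nonempty V]
    (hV : V ≤ C.f ⁻¹ᵁ ⊤) (c : K) :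
    C.X.germToFunctionField V (C.f.appLE ⊤ V hV ((Scheme.ΓSpecIso (.of K)).inv c)) =
      algebraMap K C.X.functionField c := by
  have h : C.f.appLE ⊤ V hV ≫ C.X.germToFunctionField V =
      C.f.appTop ≫ C.X.presheaf.germ ⊤ (genericPoint C.X) trivial := by
    rw [Scheme.Hom.appLE, Category.assoc, TopCat.Presheaf.germ_res]
    rfl
  exact congr($h ((Scheme.ΓSpecIso (.of K)).inv c))

namespace ClosedPoint

variable (x : C.ClosedPoint)

lemma ord_algebraMap_nonneg (a : C.X.presheaf.stalk x.1) :
    0 ≤ Scheme.ord (algebraMap _ C.X.functionField a) x.1 := by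
  by_cases ha : a = 0
  · simp [ha]
  have h : algebraMap _ C.X.functionField a ≠ 0 := by
    rwa [Ne, FaithfulSMul.algebraMap_eq_zero_iff]
  rw [Scheme.le_ord_iff x.2 h]
  have : Ring.KrullDimLE 1 (C.X.presheaf.stalk x.1) := krullDimLE_of_coheight_le x.2.le
  exact Ring.ordFrac_ge_one_of_ne_zero ha

lemma isUnit_iff_ord_eq_zero {a : C.X.presheaf.stalk x.1} (ha : a ≠ 0) :
    IsUnit a ↔ Scheme.ord (algebraMap _ C.X.functionField a) x.1 = 0 := by
  have h : algebraMap _ C.X.functionField a ≠ 0 := by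
    rwa [Ne, FaithfulSMul.algebraMap_eq_zero_iff]
  rw [Scheme.ord_eq_iff x.2 h]
  exact Ring.isUnit_iff_ordFrac_one_of_isDiscreteValuationRing

lemma exists_ord_eq_one : ∃ t : C.X.functionField, Scheme.ord t x.1 = 1 := by
  obtain ⟨ϖ, hϖ⟩ := IsDiscreteValuationRing.exists_irreducible (C.X.presheaf.stalk x.1)
  refine ⟨algebraMap _ C.X.functionField ϖ, (Scheme.ord_eq_iff x.2 ?_).mpr
    (Ring.ordFrac_irreducible hϖ)⟩
  rw [Ne, FaithfulSMul.algebraMap_eq_zero_iff]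
  exact hϖ.ne_zero

/-- The order of functions at a closed point. -/
noncomputable def orderFunction : OrderFunction K C.X.functionField where
  ord f := Scheme.ord f x.1
  ord_zero := by simp
  ord_mul := Scheme.ord_mul
  ord_add := Scheme.ord_add
  ord_algebraMap c := by
    by_cases hc : c = 0
    · simp [hc]
    have h : IsUnit (C.stalkConstants x.1 c) :=
      (IsUnit.mk0 c hc).map (C.stalkConstants x.1).hom
    rw [← algebraMap_stalkConstants x.1]
    exact (x.isUnit_iff_ord_eq_zero h.ne_zero).mp h
  exists_ord_eq_one := x.exists_ord_eq_one

lemma mem_filtration_zero_iff {f : C.X.functionField} :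
    f ∈ x.orderFunction.filtration 0 ↔
      f ∈ (algebraMap (C.X.presheaf.stalk x.1) C.X.functionField).range := by
  constructor
  · rintro (rfl | hf)
    · exact zero_mem _
    by_cases hf0 : f = 0
    · rw [hf0]
      exact zero_mem _
    obtain ⟨a, rfl⟩ | ⟨a, ha⟩ :=
      ValuationRing.isInteger_or_isInteger (C.X.presheaf.stalk x.1) f
    · exact ⟨a, rfl⟩
    have ha0 : a ≠ 0 := by
      rintro rfl
      rw [map_zero] at ha
      exact inv_ne_zero hf0 ha.symm
    have h1 : Scheme.ord (algebraMap _ C.X.functionField a) x.1 = 0 := by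
      refine le_antisymm ?_ (x.ord_algebraMap_nonneg a)
      rw [ha]
      exact (x.orderFunction.ord_inv f).trans_le (by simpa using hf)
    obtain ⟨u, rfl⟩ := (x.isUnit_iff_ord_eq_zero ha0).mpr h1
    refine ⟨(u⁻¹ : (C.X.presheaf.stalk x.1)ˣ), ?_⟩
    rw [← inv_inv f, ← ha, map_units_inv]
  · rintro ⟨a, rfl⟩
    exact Or.inr (x.ord_algebraMap_nonneg a)

lemma mem_filtration_one_iff {a : C.X.presheaf.stalk x.1} :
    algebraMap _ C.X.functionField a ∈ x.orderFunction.filtration 1 ↔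
      a ∈ IsLocalRing.maximalIdeal (C.X.presheaf.stalk x.1) := by
  by_cases ha : a = 0
  · simp [ha]
  rw [OrderFunction.mem_filtration_of_ne_zero _
    (by rwa [Ne, FaithfulSMul.algebraMap_eq_zero_iff]), IsLocalRing.mem_maximalIdeal,
    mem_nonunits_iff, x.isUnit_iff_ord_eq_zero ha]
  have := x.ord_algebraMap_nonneg a
  change 1 ≤ Scheme.ord _ x.1 ↔ _
  omega

/-- The local ring at a closed point, as the ring of functions of nonnegative order. -/
noncomputable def stalkEquiv : C.X.presheaf.stalk x.1 ≃+* x.orderFunction.integers :=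
  RingEquiv.ofBijective ((algebraMap (C.X.presheaf.stalk x.1) C.X.functionField).codRestrict
    x.orderFunction.integers fun a => x.mem_filtration_zero_iff.mpr ⟨a, rfl⟩)
    ⟨fun a b h => FaithfulSMul.algebraMap_injective _ C.X.functionField (congrArg Subtype.val h),
      fun f => by
        obtain ⟨a, ha⟩ := x.mem_filtration_zero_iff.mp f.2
        exact ⟨a, Subtype.ext ha⟩⟩

lemma coe_stalkEquiv (a : C.X.presheaf.stalk x.1) :
    (x.stalkEquiv a : C.X.functionField) = algebraMap _ C.X.functionField a := rfl

/-- The place of the function field given by a closed point. -/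
noncomputable def place : DiscretePlace K C.X.functionField (C.X.residueField x.1) where
  toOrderFunction := x.orderFunction
  res :=
    { (C.X.residue x.1).hom.comp x.stalkEquiv.symm.toRingHom with
      commutes' := fun c => by
        have h : x.stalkEquiv (C.stalkConstants x.1 c) =
            algebraMap K x.orderFunction.integers c :=
          Subtype.ext (algebraMap_stalkConstants x.1 c)
        change C.X.residue x.1 (x.stalkEquiv.symm _) = _
        rw [← h, RingEquiv.symm_apply_apply]
        exact congr($(stalkConstants_residue x.1) c) }
  res_surjective := (C.X.residue_surjective x.1).comp x.stalkEquiv.symm.surjective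
  res_eq_zero_iff f := by
    obtain ⟨a, rfl⟩ := x.stalkEquiv.surjective f
    rw [coe_stalkEquiv, mem_filtration_one_iff]
    change C.X.residue x.1 (x.stalkEquiv.symm _) = 0 ↔ _
    rw [RingEquiv.symm_apply_apply]
    exact IsLocalRing.residue_eq_zero_iff a

end ClosedPoint

instance : CompactSpace C.X := QuasiCompact.compactSpace_of_compactSpace C.f

instance : IsNoetherian C.X where

lemma finite_notMem {U : C.X.Opens} (hU : genericPoint C.X ∈ U) :
    {x : C.ClosedPoint | x.1 ∉ U}.Finite := by
  obtain ⟨S, hS, hS1, hS2, hSU⟩ :=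
    TopologicalSpace.NoetherianSpace.exists_finite_set_isClosed_irreducible U.isOpen.isClosed_compl
  refine Set.Finite.of_injOn (f := fun x => {x.1}) (t := S) (fun x hx => ?_)
    (fun x _ y _ h => Subtype.ext (Set.singleton_injective h)) hS
  have hx' : x.1 ∈ (U : Set C.X)ᶜ := hx
  rw [hSU] at hx'
  obtain ⟨t, ht, hxt⟩ := hx'
  obtain ⟨y, hy⟩ := QuasiSober.sober (hS2 t ht) (hS1 t ht)
  have hyU : y ∈ (U : Set C.X)ᶜ := by
    rw [hSU]
    exact ⟨t, ht, hy.mem⟩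
  let y' : C.ClosedPoint := ⟨y, C.coheight_eq_one fun h => hyU (h ▸ hU)⟩
  have hty : t = {y} := hy.def.symm.trans y'.isClosed.closure_eq
  rw [hty] at hxt
  change {x.1} ∈ S
  rw [Set.mem_singleton_iff.mp hxt, ← hty]
  exact ht

variable (C)

/-- The places of the function field of a curve. -/
noncomputable abbrev places (x : C.ClosedPoint) :
    DiscretePlace K C.X.functionField (C.X.residueField x.1) := x.place

lemma finitePoles_places : PlaceFamily.FinitePoles C.places := by
  intro f
  by_cases hf : f = 0
  · simp [hf, (C.places _).ord_zero]
  obtain ⟨U, -, f', hU, rfl, hf'⟩ := exists_isUnit_germ_eq _ f hf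
  refine (finite_notMem (((genericPoint_spec C.X).mem_open_set_iff U.isOpen).mpr
    (by simpa using hU))).subset fun x hx hxU => ?_
  have : Scheme.ord (C.X.germToFunctionField U f') x.1 = 0 := Scheme.ord_of_isUnit hf' hxU
  exact (hx : Scheme.ord _ x.1 < 0).ne this

lemma degree_eq (D : C.Divisor) :
    C.degree D = PlaceFamily.deg K (fun x : C.ClosedPoint => C.X.residueField x.1) D := by
  simp [degree, PlaceFamily.deg, residueDegree_eq]

lemma riemannRochSpace_eq (D : C.Divisor) :
    C.riemannRochSpace D = PlaceFamily.space C.places D := by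
  refine le_antisymm (Submodule.span_le.mpr fun h hh => (PlaceFamily.mem_space_iff _).mpr
    (Or.inr hh.2)) fun h hh => ?_
  by_cases h0 : h = 0
  · rw [h0]
    exact zero_mem _
  exact Submodule.subset_span ⟨h0, ((PlaceFamily.mem_space_iff _).mp hh).resolve_left h0⟩

lemma ell_eq (D : C.Divisor) : C.ell D = PlaceFamily.ell C.places D := by
  rw [ell, riemannRochSpace_eq, PlaceFamily.ell]

lemma isGenus_genus [Nonempty C.ClosedPoint] (h : 1 ≤ C.genus) :
    PlaceFamily.IsGenus C.places C.genus := by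
  have h1 := PlaceFamily.isGenus_sSup (P := C.places)
  simp only [← degree_eq, ← ell_eq] at h1
  exact h1 h

end Curve

/-- The map on function fields induced by a dominant morphism of integral schemes. -/
noncomputable def AlgebraicGeometry.Scheme.Hom.functionFieldMap {X Y : Scheme.{u}} [IsIntegral X]
    [IsIntegral Y] (f : X ⟶ Y) (hf : f (genericPoint X) = genericPoint Y) :
    Y.functionField →+* X.functionField :=
  (Y.presheaf.stalkSpecializes (specializes_of_eq hf) ≫ f.stalkMap (genericPoint X)).hom

lemma AlgebraicGeometry.Scheme.Hom.functionFieldMap_algebraMap {X Y : Scheme.{u}} [IsIntegral X]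
    [IsIntegral Y] (f : X ⟶ Y) (hf : f (genericPoint X) = genericPoint Y) (x : X)
    (a : Y.presheaf.stalk (f x)) :
    f.functionFieldMap hf (algebraMap _ _ a) = algebraMap (X.presheaf.stalk x) _
      (f.stalkMap x a) := by
  have h := Scheme.Hom.stalkSpecializes_stalkMap f _ _ (genericPoint_specializes x)
  have h2 : Y.presheaf.stalkSpecializes (genericPoint_specializes (f x)) ≫
      Y.presheaf.stalkSpecializes (specializes_of_eq hf) =
      Y.presheaf.stalkSpecializes ((genericPoint_specializes x).map f.continuous) :=
    TopCat.Presheaf.stalkSpecializes_comp _ _ _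
  have h3 := (h2 =≫ f.stalkMap (genericPoint X)).trans h
  exact congr($h3 a)

lemma AlgebraicGeometry.Scheme.Hom.functionFieldMap_germ {X Y : Scheme.{u}} [IsIntegral X]
    [IsIntegral Y] (f : X ⟶ Y) (hf : f (genericPoint X) = genericPoint Y) {U : Y.Opens}
    {V : X.Opens} [Nonempty U] [Nonempty V] (hUV : V ≤ f ⁻¹ᵁ U) (a : Γ(Y, U)) :
    f.functionFieldMap hf (Y.germToFunctionField U a) =
      X.germToFunctionField V (f.appLE U V hUV a) := by
  let x : V := Classical.arbitrary V
  rw [← Scheme.algebraMap_germ_eq_germToFunctionField Y (x := f x.1) (hUV x.2),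
    functionFieldMap_algebraMap, ← Scheme.algebraMap_germ_eq_germToFunctionField X (x := x.1) x.2]
  have hx : f x.1 ∈ U := hUV x.2
  have h : Y.presheaf.germ U (f x.1) hx ≫ f.stalkMap x.1 =
      f.appLE U V hUV ≫ X.presheaf.germ V x.1 x.2 := by
    rw [Scheme.Hom.germ_stalkMap, Scheme.Hom.appLE, Category.assoc, TopCat.Presheaf.germ_res]
  exact congr(algebraMap (X.presheaf.stalk x.1) X.functionField ($h a))

namespace Curve

variable {K : Type u} [Field K] {C C' : Curve K}

namespace Hom

variable (π : C.Hom C')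

lemma stalkConstants_stalkMap (x : C.X) :
    C'.stalkConstants (π.toHom x) ≫ π.toHom.stalkMap x = C.stalkConstants x := by
  apply Spec.map_injective
  rw [Spec.map_comp, SpecMap_stalkConstants, SpecMap_stalkConstants,
    Scheme.SpecMap_stalkMap_fromSpecStalk_assoc, π.comp_f]

variable {π}

lemma Nonconstant.apply_genericPoint (hπ : π.Nonconstant) :
    π.toHom (genericPoint C.X) = genericPoint C'.X := by
  by_contra h
  let y : C'.ClosedPoint := ⟨_, C'.coheight_eq_one h⟩
  obtain ⟨_, ⟨a, rfl⟩, _, ⟨b, rfl⟩, hab⟩ := hπ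
  have key (x : C.X) : π.toHom x = y.1 := by
    have h1 : y.1 ⤳ π.toHom x := (genericPoint_specializes x).map π.toHom.continuous
    exact h1.mem_closed y.isClosed rfl
  exact hab ((key a).trans (key b).symm)

lemma Nonconstant.nonempty_source (hπ : π.Nonconstant) : Nonempty C.ClosedPoint := by
  obtain ⟨_, ⟨a, rfl⟩, _, ⟨b, rfl⟩, hab⟩ := hπ
  by_cases ha : a = genericPoint C.X
  · exact ⟨b, C.coheight_eq_one fun hb => hab (by rw [ha, hb])⟩
  · exact ⟨a, C.coheight_eq_one ha⟩

lemma Nonconstant.nonempty_target (hπ : π.Nonconstant) : Nonempty C'.ClosedPoint := by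
  obtain ⟨a, -, b, -, hab⟩ := hπ
  by_cases ha : a = genericPoint C'.X
  · exact ⟨b, C'.coheight_eq_one fun hb => hab (by rw [ha, hb])⟩
  · exact ⟨a, C'.coheight_eq_one ha⟩

/-- The map induced by a nonconstant morphism on function fields. -/
noncomputable abbrev Nonconstant.functionFieldMap (hπ : π.Nonconstant) :
    C'.X.functionField →+* C.X.functionField :=
  π.toHom.functionFieldMap hπ.apply_genericPoint

lemma Nonconstant.functionFieldMap_constants (hπ : π.Nonconstant) (c : K) :
    hπ.functionFieldMap (algebraMap K _ c) = algebraMap K _ c := by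
  rw [← algebraMap_stalkConstants (π.toHom (genericPoint C.X)),
    Scheme.Hom.functionFieldMap_algebraMap, ← algebraMap_stalkConstants (genericPoint C.X),
    ← stalkConstants_stalkMap π]
  rfl

lemma bijective_residue_genericPoint (C : Curve K) :
    Function.Bijective (C.X.residue (genericPoint C.X)) := by
  refine ⟨?_, C.X.residue_surjective _⟩
  exact RingHom.injective (C.X.residue (genericPoint C.X)).hom

lemma Nonconstant.finrank_functionField (hπ : π.Nonconstant) :
    @Module.finrank C'.X.functionField C.X.functionField _ _
      hπ.functionFieldMap.toAlgebra.toModule = π.deg := by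
  let := hπ.functionFieldMap.toAlgebra
  let := (π.toHom.residueFieldMap (genericPoint C.X)).hom.toAlgebra
  let i : C'.X.functionField ⟶ C'.X.residueField (π.toHom (genericPoint C.X)) :=
    C'.X.presheaf.stalkSpecializes (specializes_of_eq hπ.apply_genericPoint) ≫
      C'.X.residue _
  have hi : Function.Bijective i.hom := by
    refine ⟨i.hom.injective, ?_⟩
    have : IsIso (C'.X.presheaf.stalkSpecializes (specializes_of_eq hπ.apply_genericPoint)) :=
      (C'.X.presheaf.stalkCongr (.of_eq hπ.apply_genericPoint.symm)).isIso_hom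
    exact (C'.X.residue_surjective _).comp (ConcreteCategory.bijective_of_isIso
      (C'.X.presheaf.stalkSpecializes (specializes_of_eq hπ.apply_genericPoint))).2
  refine Algebra.finrank_eq_of_equiv_equiv (RingEquiv.ofBijective i.hom hi)
    (RingEquiv.ofBijective (C.X.residue (genericPoint C.X)).hom
      (bijective_residue_genericPoint C)) ?_
  have := C'.X.presheaf.stalkSpecializes (specializes_of_eq hπ.apply_genericPoint) ≫=
    Scheme.residue_residueFieldMap π.toHom (genericPoint C.X)
  exact (congrArg CommRingCat.Hom.hom this :)

lemma Nonconstant.liesAbove (hπ : π.Nonconstant) :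
    letI := hπ.functionFieldMap.toAlgebra
    PlaceFamily.LiesAbove C.places C'.places := by
  let := hπ.functionFieldMap.toAlgebra
  intro x
  have key (a : C'.X.presheaf.stalk (π.toHom x.1)) :
      0 ≤ x.place.ord (algebraMap C'.X.functionField C.X.functionField (algebraMap _ _ a)) := by
    change 0 ≤ Scheme.ord (hπ.functionFieldMap _) x.1
    rw [Scheme.Hom.functionFieldMap_algebraMap]
    exact x.ord_algebraMap_nonneg _
  by_cases hx : π.toHom x.1 = genericPoint C'.X
  · refine Or.inr fun f => ?_
    have : IsIso (C'.X.presheaf.stalkSpecializes (genericPoint_specializes (π.toHom x.1))) :=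
      (C'.X.presheaf.stalkCongr (.of_eq hx)).isIso_hom
    obtain ⟨a, rfl⟩ := (ConcreteCategory.bijective_of_isIso
      (C'.X.presheaf.stalkSpecializes (genericPoint_specializes (π.toHom x.1)))).2 f
    exact key a
  · refine Or.inl ⟨⟨_, C'.coheight_eq_one hx⟩, fun f hf => ?_⟩
    obtain ⟨a, rfl⟩ := (ClosedPoint.mem_filtration_zero_iff _).mp (Or.inr hf)
    exact key a

end Hom

/-- The inequality satisfied by the residue field of a closed point that is the only pole, and a
simple one, of some function. -/
theorem Hom.Nonconstant.genus_le {π : C.Hom C'} (hπ : π.Nonconstant) (hg : 1 ≤ C.genus)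
    (hg' : 1 ≤ C'.genus) {q : C.ClosedPoint} {h : C.X.functionField} (hh : Transcendental K h)
    (hhD : h ∈ PlaceFamily.space C.places (Finsupp.single q 1))
    (hprim : (∀ L : IntermediateField K (C.X.residueField q.1), L = ⊥ ∨ L = ⊤) ∨
      Nat.gcd (Module.finrank K (C.X.residueField q.1)) π.deg = 1) :
    (C.genus : ℤ) ≤ π.deg * C'.genus +
      (π.deg - 1) * (Module.finrank K (C.X.residueField q.1) - 1) := by
  let := hπ.functionFieldMap.toAlgebra
  have : IsScalarTower K C'.X.functionField C.X.functionField :=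
    .of_algebraMap_eq fun c => (hπ.functionFieldMap_constants c).symm
  have := hπ.nonempty_source
  have := hπ.nonempty_target
  let y := Classical.arbitrary C'.ClosedPoint
  obtain ⟨u, hu⟩ := y.orderFunction.exists_ord_eq_one
  rw [← hπ.finrank_functionField] at hprim ⊢
  exact PlaceFamily.not_lt_genus (C.isGenus_genus hg) C.finitePoles_places
    (C'.isGenus_genus hg') C'.finitePoles_places hπ.liesAbove (by exact_mod_cast hg')
    (y.orderFunction.transcendental_of_ord_ne_zero (by rw [hu]; exact one_ne_zero)) hh hhD hprim

end Curve

lemma trdeg_le_one_of_isStandardSmooth {k S F : Type*} [Field k] [CommRing S] [IsDomain S] [Field F]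
    [Algebra S F] [Algebra k F] [IsFractionRing S F] {f : k →+* S}
    (hf : f.IsStandardSmoothOfRelativeDimension 1) (hkF : algebraMap k F = (algebraMap S F).comp f) :
    Algebra.trdeg k F ≤ 1 ∧ Algebra.EssFiniteType k F := by
  obtain ⟨g, hgf, hg⟩ := hf.exists_etale_mvPolynomial
  let R := MvPolynomial (Fin 1) k
  algebraize [f, g]
  have : IsScalarTower k S F := .of_algebraMap_eq' hkF
  let : Algebra R F := ((algebraMap S F).comp g).toAlgebra
  have : IsScalarTower R S F := .of_algebraMap_eq' rfl
  have : IsScalarTower k R F := .of_algebraMap_eq' (by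
    rw [hkF, IsScalarTower.algebraMap_eq R S F, RingHom.comp_assoc]
    congr 1
    exact hgf.symm)
  have hinj : Function.Injective (algebraMap R F) := by
    have : Module.Flat R S := inferInstance
    have : FaithfulSMul R S := inferInstance
    exact (FaithfulSMul.algebraMap_injective S F).comp (FaithfulSMul.algebraMap_injective R S)
  have hSF : Algebra.EssFiniteType S F := .of_isLocalization F (nonZeroDivisors S)
  have hRF : Algebra.EssFiniteType R F := .comp R S F
  have hkF : Algebra.EssFiniteType k F := .comp k R F
  refine ⟨?_, hkF⟩
  have : FaithfulSMul R F := (faithfulSMul_iff_algebraMap_injective R F).mpr hinj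
  let : Algebra (FractionRing R) F := FractionRing.liftAlgebra R F
  have h1 : Algebra.FormallyUnramified S F := .of_isLocalization (nonZeroDivisors S)
  have h2 : Algebra.FormallyUnramified R F := .comp R S F
  have h3 : Algebra.FormallyUnramified (FractionRing R) F := .of_restrictScalars R _ _
  have h4 : Algebra.EssFiniteType (FractionRing R) F := .of_comp R _ _
  have h5 : Algebra.IsSeparable (FractionRing R) F := Algebra.FormallyUnramified.isSeparable _ _
  have h6 : Algebra.IsAlgebraic R F :=
    (IsFractionRing.comap_isAlgebraic_iff (K := FractionRing R)).mpr inferInstance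
  let x : Fin 1 → F := fun i => algebraMap R F (MvPolynomial.X i)
  have h7 : Algebra.IsAlgebraic (Algebra.adjoin k (Set.range x)) F := by
    have hmem (p : R) : algebraMap R F p ∈ Algebra.adjoin k (Set.range x) := by
      rw [Algebra.adjoin_range_eq_range_aeval]
      refine ⟨p, ?_⟩
      have : MvPolynomial.aeval x = IsScalarTower.toAlgHom k R F :=
        MvPolynomial.algHom_ext fun i => by
          rw [MvPolynomial.aeval_X]
          rfl
      exact congr($this p)
    let : Algebra R (Algebra.adjoin k (Set.range x)) :=
      ((algebraMap R F).codRestrict (Algebra.adjoin k (Set.range x)) hmem).toAlgebra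
    have : IsScalarTower R (Algebra.adjoin k (Set.range x)) F := .of_algebraMap_eq' rfl
    exact Algebra.IsAlgebraic.extendScalars (R := R)
      (fun a b hab => hinj (congrArg Subtype.val hab))
  exact (Algebra.IsAlgebraic.trdeg_le_cardinalMk k (Set.range x)).trans
    (by rw [Cardinal.mk_le_one_iff_set_subsingleton]; exact Set.subsingleton_range x)

/-- A finitely generated field of transcendence degree one is finite over every subfield that is
not algebraic. -/
lemma finiteDimensional_of_trdeg_le_one {K F F' : Type*} [Field K] [Field F] [Field F']
    [Algebra K F] [Algebra K F'] [Algebra F' F] [IsScalarTower K F' F] [Algebra.EssFiniteType K F]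
    (h : Algebra.trdeg K F ≤ 1) {u : F'} (hu : Transcendental K u) : FiniteDimensional F' F := by
  have hu' : Transcendental K (algebraMap F' F u) := by
    rwa [transcendental_algebraMap_iff (algebraMap F' F).injective]
  have h1 := (algebraicIndependent_singleton_iff (x := fun _ : Fin 1 => algebraMap F' F u)
    0).mpr hu' |>.isTranscendenceBasis_of_lift_trdeg_le_of_finite (by simpa using h)
  have h2 := h1.isAlgebraic
  have hle : Algebra.adjoin K (Set.range fun _ : Fin 1 => algebraMap F' F u) ≤
      (IsScalarTower.toAlgHom K F' F).range :=
    Algebra.adjoin_le (by rintro _ ⟨i, rfl⟩; exact ⟨u, rfl⟩)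
  have h3 : Algebra.IsAlgebraic F' F := by
    have h4 (y : F) : IsAlgebraic (IsScalarTower.toAlgHom K F' F).range y :=
      IsAlgebraic.tower_top_of_subalgebra_le hle (h2.isAlgebraic y)
    exact ⟨fun y => IsAlgebraic.of_ringHom_of_comp_eq
      (IsScalarTower.toAlgHom K F' F).rangeRestrict.toRingHom (RingHom.id F) (h4 y)
      (IsScalarTower.toAlgHom K F' F).rangeRestrict_surjective Function.injective_id rfl⟩
  have : Algebra.EssFiniteType F' F := .of_comp K F' F
  exact Algebra.finite_of_essFiniteType_of_isAlgebraic

namespace Curve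

variable {K : Type u} [Field K] {C C' : Curve K}

variable (C) in
lemma trdeg_functionField_le_one :
    Algebra.trdeg K C.X.functionField ≤ 1 ∧ Algebra.EssFiniteType K C.X.functionField := by
  obtain ⟨U, hU, V, hV, hx, e, hf⟩ :=
    C.smooth.exists_isStandardSmoothOfRelativeDimension (genericPoint C.X)
  have hUtop : U = ⊤ := by
    ext y
    simpa [Subsingleton.elim y (C.f (genericPoint C.X))] using e hx
  subst hUtop
  have : Nonempty V := ⟨⟨_, hx⟩⟩
  have := functionField_isFractionRing_of_isAffineOpen C.X V hV
  have h2 := hf.comp (RingHom.IsStandardSmoothOfRelativeDimension.equiv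
    (Scheme.ΓSpecIso (.of K)).symm.commRingCatIsoToRingEquiv)
  exact trdeg_le_one_of_isStandardSmooth h2
    (RingHom.ext fun c => (C.germToFunctionField_appLE e c).symm)

lemma Hom.Nonconstant.deg_pos {π : C.Hom C'} (hπ : π.Nonconstant) : 0 < π.deg := by
  let := hπ.functionFieldMap.toAlgebra
  have : IsScalarTower K C'.X.functionField C.X.functionField :=
    .of_algebraMap_eq fun c => (hπ.functionFieldMap_constants c).symm
  have := hπ.nonempty_target
  let y := Classical.arbitrary C'.ClosedPoint
  obtain ⟨u, hu⟩ := y.orderFunction.exists_ord_eq_one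
  obtain ⟨h1, h2⟩ := C.trdeg_functionField_le_one
  have := finiteDimensional_of_trdeg_le_one h1
    (y.orderFunction.transcendental_of_ord_ne_zero (f := u) (by rw [hu]; exact one_ne_zero))
  rw [← hπ.finrank_functionField]
  exact Module.finrank_pos

end Curve

section FractionFields

variable {A B F L ι : Type*} [CommRing A] [CommRing B] [Algebra A B]
  [Field F] [Field L] [Algebra A F] [IsFractionRing A F] [Algebra B L]
  [Algebra F L] [Algebra A L] [IsScalarTower A B L] [IsScalarTower A F L]

include A in
/-- A basis of an extension of domains is linearly independent over the fraction field. -/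
lemma Module.Basis.linearIndependent_algebraMap_fractionRing [IsFractionRing B L]
    (b : Module.Basis ι A B) :
    LinearIndependent F fun i => algebraMap B L (b i) := by
  rw [← LinearIndependent.iff_fractionRing A F]
  exact b.linearIndependent.map' (IsScalarTower.toAlgHom A B L).toLinearMap
    (LinearMap.ker_eq_bot.mpr (FaithfulSMul.algebraMap_injective B L))

/-- If an element of the fraction field of `B` is integral at all primes over `p`, then its
coordinates in an `A`-basis of `B` are integral at `p`. -/
lemma Module.Basis.exists_linearCombination_of_forall_prime [Algebra.IsIntegral A B]
    (b : Module.Basis ι A B) (p : Ideal A) [p.IsPrime] (f : L)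
    (hf : ∀ Q : Ideal B, Q.IsPrime → Q.comap (algebraMap A B) = p →
      ∃ s ∉ Q, ∃ c, algebraMap B L c = algebraMap B L s * f) :
    ∃ v : ι →₀ F, f = Finsupp.linearCombination F (fun i => algebraMap B L (b i)) v ∧
      ∃ s ∉ p, ∀ i, ∃ a, algebraMap A F s * v i = algebraMap A F a := by
  let I : Ideal B :=
    { carrier := {s | ∃ c, algebraMap B L c = algebraMap B L s * f}
      zero_mem' := ⟨0, by simp⟩
      add_mem' := by
        rintro s t ⟨c, hc⟩ ⟨d, hd⟩
        exact ⟨c + d, by rw [map_add, map_add, add_mul, hc, hd]⟩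
      smul_mem' := by
        rintro t s ⟨c, hc⟩
        exact ⟨t * c, by rw [smul_eq_mul, map_mul, map_mul, hc, mul_assoc]⟩ }
  have hI : ¬ I.comap (algebraMap A B) ≤ p := by
    intro h
    obtain ⟨Q, hIQ, hQ, hQp⟩ := Ideal.exists_ideal_over_prime_of_isIntegral p I h
    obtain ⟨s, hs, hsI⟩ := hf Q hQ hQp
    exact hs (hIQ hsI)
  obtain ⟨s, ⟨c, hc⟩, hsp⟩ := SetLike.not_le_iff_exists.mp hI
  have hs0 : algebraMap A F s ≠ 0 := by
    rw [Ne, FaithfulSMul.algebraMap_eq_zero_iff]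
    rintro rfl
    exact hsp p.zero_mem
  refine ⟨(b.repr c).mapRange (fun a => (algebraMap A F s)⁻¹ * algebraMap A F a) (by simp),
    ?_, s, hsp, fun i => ⟨b.repr c i, by simp [mul_inv_cancel_left₀ hs0]⟩⟩
  have h1 : algebraMap B L c = Finsupp.linearCombination F (fun i => algebraMap B L (b i))
      ((b.repr c).mapRange (algebraMap A F) (map_zero _)) := by
    conv_lhs => rw [← b.linearCombination_repr c]
    rw [Finsupp.linearCombination_apply, Finsupp.linearCombination_apply,
      Finsupp.sum_mapRange_index (by simp), map_finsuppSum]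
    refine Finsupp.sum_congr fun i _ => ?_
    rw [Algebra.smul_def, Algebra.smul_def, map_mul, ← IsScalarTower.algebraMap_apply,
      ← IsScalarTower.algebraMap_apply]
  have h2 : (b.repr c).mapRange (fun a => (algebraMap A F s)⁻¹ * algebraMap A F a) (by simp) =
      (algebraMap A F s)⁻¹ • (b.repr c).mapRange (algebraMap A F) (map_zero _) := by
    ext i
    simp
  rw [h2, map_smul, ← h1, hc, ← IsScalarTower.algebraMap_apply A B L,
    IsScalarTower.algebraMap_apply A F L, Algebra.smul_def, map_inv₀, inv_mul_cancel_left₀]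
  rwa [Ne, FaithfulSMul.algebraMap_eq_zero_iff]

end FractionFields

instance : Algebra.IsAlgebraic ℚ Curve.Qbar := by
  have h : (DivisionRing.toRatAlgebra : Algebra ℚ Curve.Qbar) =
      AlgebraicClosure.instAlgebra (k := ℚ) := Subsingleton.elim _ _
  rw [h]
  exact AlgebraicClosure.isAlgebraic ℚ

instance : IsIntegralHom Curve.specQbar := by
  rw [IsIntegralHom.SpecMap_iff]
  exact (algebraMap_isIntegral_iff (R := ℚ) (A := Curve.Qbar)).mpr
    Algebra.IsAlgebraic.isIntegral

instance : Surjective Curve.specQbar :=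
  ⟨fun _ => ⟨Classical.arbitrary _, Subsingleton.elim _ _⟩⟩

namespace Curve

variable (C : Curve ℚ)

/-- The projection from the geometric fibre. -/
noncomputable abbrev projection : C.geometricFibre.X ⟶ C.X := pullback.fst C.f specQbar

lemma isPullback_projection :
    IsPullback C.projection C.geometricFibre.f C.f specQbar := IsPullback.of_hasPullback _ _

instance : IsIntegralHom C.projection :=
  MorphismProperty.of_isPullback C.isPullback_projection.flip inferInstance

instance : Surjective C.projection :=
  MorphismProperty.of_isPullback C.isPullback_projection.flip inferInstance

lemma projection_genericPoint :
    C.projection (genericPoint C.geometricFibre.X) = genericPoint C.X := by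
  refine IsGenericPoint.eq ?_ (genericPoint_spec C.X)
  have h := (genericPoint_spec C.geometricFibre.X).image C.projection.continuous
  rwa [Set.image_univ, C.projection.surjective.range_eq, closure_univ] at h

noncomputable instance : Algebra C.X.functionField C.geometricFibre.X.functionField :=
  (C.projection.functionFieldMap C.projection_genericPoint).toAlgebra

/-- A basis of the algebraic numbers over `ℚ` gives a basis of the functions on the preimage of an
affine open subset of the curve over the functions on this subset. -/
lemma exists_basis_sections {ι : Type*} (c : Module.Basis ι ℚ Qbar) {U : C.X.Opens}
    (hU : IsAffineOpen U) :
    letI := (C.projection.appLE U (C.projection ⁻¹ᵁ U) le_rfl).hom.toAlgebra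
    ∃ b : Module.Basis ι Γ(C.X, U) Γ(C.geometricFibre.X, C.projection ⁻¹ᵁ U),
      ∀ i, b i = C.geometricFibre.f.appLE ⊤ (C.projection ⁻¹ᵁ U) le_top
        ((Scheme.ΓSpecIso (.of Qbar)).inv (c i)) := by
  let V := C.projection ⁻¹ᵁ U
  have h1 : IsPushout (C.f.appLE ⊤ U le_top) (specQbar.appLE ⊤ ⊤ le_top)
      (C.projection.appLE U V le_rfl) (C.geometricFibre.f.appLE ⊤ V le_top) :=
    (isIso_pushoutSection_iff C.isPullback_projection (US := ⊤) (UT := ⊤) (UX := U) (UY := V)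
      le_top le_top (by simp [V])).mp
      (isIso_pushoutSection_of_isAffineOpen _ _ _ _ (isAffineOpen_top _) (isAffineOpen_top _) hU)
  let α : CommRingCat.of ℚ ⟶ Γ(C.X, U) := (Scheme.ΓSpecIso (.of ℚ)).inv ≫ C.f.appLE ⊤ U le_top
  let β : CommRingCat.of Qbar ⟶ Γ(C.geometricFibre.X, V) :=
    (Scheme.ΓSpecIso (.of Qbar)).inv ≫ C.geometricFibre.f.appLE ⊤ V le_top
  have h2 : IsPushout α (CommRingCat.ofHom (algebraMap ℚ Qbar))
      (C.projection.appLE U V le_rfl) β := by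
    refine h1.of_iso (Scheme.ΓSpecIso (.of ℚ)) (Iso.refl _) (Scheme.ΓSpecIso (.of Qbar))
      (Iso.refl _) (by simp [α]) ?_ (by simp) (by simp [β])
    have : specQbar.appLE ⊤ ⊤ le_top = specQbar.appTop := Scheme.Hom.appLE_eq_app _
    rw [this]
    exact Scheme.ΓSpecIso_naturality _
  let := α.hom.toAlgebra
  let := β.hom.toAlgebra
  let := (C.projection.appLE U V le_rfl).hom.toAlgebra
  let := (α ≫ C.projection.appLE U V le_rfl).hom.toAlgebra
  have : IsScalarTower ℚ Γ(C.X, U) Γ(C.geometricFibre.X, V) := .of_algebraMap_eq' rfl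
  have : IsScalarTower ℚ Qbar Γ(C.geometricFibre.X, V) :=
    .of_algebraMap_eq' (congrArg CommRingCat.Hom.hom h2.w)
  have h3 : Algebra.IsPushout ℚ Γ(C.X, U) Qbar Γ(C.geometricFibre.X, V) :=
    CommRingCat.isPushout_iff_isPushout.mp h2
  exact ⟨IsBaseChange.basis c h3.out, fun i => IsBaseChange.basis_apply c h3.out i⟩

end Curve

lemma AlgebraicGeometry.IsAffineOpen.mem_range_stalk_iff {X : Scheme.{u}} [IsIntegral X]
    {U : X.Opens} (hU : IsAffineOpen U) [Nonempty U] (x : U) (f : X.functionField) :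
    f ∈ (algebraMap (X.presheaf.stalk x.1) X.functionField).range ↔
      ∃ s ∉ (hU.primeIdealOf x).asIdeal, ∃ a : Γ(X, U),
        algebraMap _ X.functionField a = algebraMap _ X.functionField s * f := by
  have := hU.isLocalization_stalk x
  let := TopCat.Presheaf.algebra_section_stalk X.presheaf x
  have := functionField_isScalarTower X U x
  constructor
  · rintro ⟨z, rfl⟩
    obtain ⟨⟨a, s⟩, h⟩ := IsLocalization.surj (hU.primeIdealOf x).asIdeal.primeCompl z
    refine ⟨s, s.2, a, ?_⟩
    rw [IsScalarTower.algebraMap_apply _ (X.presheaf.stalk x.1) X.functionField a, ← h, map_mul,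
      ← IsScalarTower.algebraMap_apply, mul_comm]
  · rintro ⟨s, hs, a, h⟩
    have h1 : IsUnit (algebraMap Γ(X, U) (X.presheaf.stalk x.1) s) :=
      IsLocalization.map_units _ (⟨s, hs⟩ : (hU.primeIdealOf x).asIdeal.primeCompl)
    have h2 : algebraMap Γ(X, U) X.functionField s ≠ 0 := by
      rw [IsScalarTower.algebraMap_apply _ (X.presheaf.stalk x.1)]
      exact (h1.map _).ne_zero
    obtain ⟨w, hw⟩ := h1.exists_right_inv
    refine ⟨w * algebraMap _ _ a, mul_left_cancel₀ h2 ?_⟩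
    rw [← h, IsScalarTower.algebraMap_apply _ (X.presheaf.stalk x.1) X.functionField s, ← map_mul,
      ← mul_assoc, hw, one_mul, ← IsScalarTower.algebraMap_apply]

namespace Curve

variable {C : Curve ℚ} {ι : Type*} (c : Module.Basis ι ℚ Qbar)

/-- A basis of the algebraic numbers is linearly independent over the function field of the curve,
and the coordinates of a function that is regular at all points over `x` are regular at `x`. -/
lemma exists_linearCombination_and_linearIndependent (x : C.X) :
    (LinearIndependent C.X.functionField
      fun i => algebraMap Qbar C.geometricFibre.X.functionField (c i)) ∧
    ∀ f : C.geometricFibre.X.functionField,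
      (∀ y : C.geometricFibre.X, C.projection y = x →
        f ∈ (algebraMap (C.geometricFibre.X.presheaf.stalk y) _).range) →
      ∃ v : ι →₀ C.X.functionField, f = Finsupp.linearCombination C.X.functionField
        (fun i => algebraMap Qbar C.geometricFibre.X.functionField (c i)) v ∧
        ∀ i, v i ∈ (algebraMap (C.X.presheaf.stalk x) _).range := by
  obtain ⟨U, hU, hxU, -⟩ := exists_isAffineOpen_mem_and_subset (show x ∈ (⊤ : C.X.Opens) from trivial)
  let V := C.projection ⁻¹ᵁ U
  have hV : IsAffineOpen V := hU.preimage C.projection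
  have : Nonempty U := ⟨⟨x, hxU⟩⟩
  have : Nonempty V := by
    obtain ⟨y, hy⟩ := C.projection.surjective x
    exact ⟨y, show C.projection y ∈ U from hy ▸ hxU⟩
  let := (C.projection.appLE U V le_rfl).hom.toAlgebra
  obtain ⟨b, hb⟩ := C.exists_basis_sections c hU
  have : IsFractionRing Γ(C.X, U) C.X.functionField :=
    functionField_isFractionRing_of_isAffineOpen C.X U hU
  have : IsFractionRing Γ(C.geometricFibre.X, V) C.geometricFibre.X.functionField :=
    functionField_isFractionRing_of_isAffineOpen C.geometricFibre.X V hV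
  let : Algebra Γ(C.X, U) C.geometricFibre.X.functionField :=
    ((algebraMap Γ(C.geometricFibre.X, V) C.geometricFibre.X.functionField).comp
      (algebraMap Γ(C.X, U) Γ(C.geometricFibre.X, V))).toAlgebra
  have : IsScalarTower Γ(C.X, U) Γ(C.geometricFibre.X, V) C.geometricFibre.X.functionField :=
    .of_algebraMap_eq' rfl
  have : IsScalarTower Γ(C.X, U) C.X.functionField C.geometricFibre.X.functionField :=
    .of_algebraMap_eq fun a => (Scheme.Hom.functionFieldMap_germ C.projection
      C.projection_genericPoint le_rfl a).symm
  have : Algebra.IsIntegral Γ(C.X, U) Γ(C.geometricFibre.X, V) := by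
    have h := IsIntegralHom.isIntegral_app C.projection U hU
    rw [← Scheme.Hom.appLE_eq_app] at h
    exact algebraMap_isIntegral_iff.mp h
  have hbc : (fun i => algebraMap Γ(C.geometricFibre.X, V) C.geometricFibre.X.functionField
      (b i)) = fun i => algebraMap Qbar C.geometricFibre.X.functionField (c i) := by
    funext i
    rw [hb i]
    exact C.geometricFibre.germToFunctionField_appLE _ _
  rw [← hbc]
  refine ⟨b.linearIndependent_algebraMap_fractionRing, fun f hf => ?_⟩
  obtain ⟨v, hv, s, hs, hsv⟩ := b.exists_linearCombination_of_forall_prime (F := C.X.functionField)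
    (hU.primeIdealOf ⟨x, hxU⟩).asIdeal f fun Q hQ hQp => by
      let y := hV.fromSpec ⟨Q, hQ⟩
      have hy : y ∈ V := by
        have : y ∈ Set.range hV.fromSpec := ⟨_, rfl⟩
        rwa [hV.range_fromSpec] at this
      have hyQ : hV.primeIdealOf ⟨y, hy⟩ = ⟨Q, hQ⟩ :=
        hV.fromSpec.isOpenEmbedding.injective (hV.fromSpec_primeIdealOf ⟨y, hy⟩)
      have hyx : C.projection y = x := by
        have h1 := IsAffineOpen.comap_primeIdealOf_appLE U hU V hV le_rfl hy
        have h2 : hU.primeIdealOf ⟨C.projection y, hy⟩ = hU.primeIdealOf ⟨x, hxU⟩ := by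
          rw [← h1, hyQ]
          exact PrimeSpectrum.ext hQp
        have h3 := congrArg hU.fromSpec h2
        rwa [hU.fromSpec_primeIdealOf, hU.fromSpec_primeIdealOf] at h3
      have h4 := (hV.mem_range_stalk_iff ⟨y, hy⟩ f).mp (hf y hyx)
      rwa [hyQ] at h4
  refine ⟨v, hv, fun i => (hU.mem_range_stalk_iff ⟨x, hxU⟩ (v i)).mpr ⟨s, hs, ?_⟩⟩
  obtain ⟨a, ha⟩ := hsv i
  exact ⟨a, ha.symm⟩

end Curve

namespace Curve

variable {C : Curve ℚ}

/-- A point of the geometric fibre over a closed point, as a closed point. -/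
def closedPointOver (x : C.ClosedPoint) (y : C.geometricFibre.X) (hy : C.projection y = x.1) :
    C.geometricFibre.ClosedPoint :=
  ⟨y, C.geometricFibre.coheight_eq_one fun h =>
    x.ne_genericPoint (by rw [← hy, h, C.projection_genericPoint])⟩

lemma algebraMap_mem_filtration_one (x : C.ClosedPoint) (y : C.geometricFibre.X)
    (hy : C.projection y = x.1) {t : C.X.functionField} (ht : t ∈ x.orderFunction.filtration 1) :
    algebraMap C.X.functionField C.geometricFibre.X.functionField t ∈
      (closedPointOver x y hy).orderFunction.filtration 1 := by
  obtain ⟨a, rfl⟩ := x.mem_filtration_zero_iff.mp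
    (x.orderFunction.filtration_anti zero_le_one ht)
  rw [x.mem_filtration_one_iff] at ht
  have hco : Order.coheight (C.projection y) = 1 := by rw [hy, x.2]
  obtain rfl : x = ⟨C.projection y, hco⟩ := Subtype.ext hy.symm
  have h : algebraMap C.X.functionField C.geometricFibre.X.functionField (algebraMap _ _ a) = _ :=
    Scheme.Hom.functionFieldMap_algebraMap C.projection C.projection_genericPoint y a
  rw [h]
  refine (ClosedPoint.mem_filtration_one_iff (closedPointOver ⟨_, hco⟩ y rfl)).mpr ?_
  exact (map_mem_nonunits_iff (C.projection.stalkMap y).hom a).mpr ht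

lemma exists_transcendental_mem_space {p q : C.ClosedPoint}
    {f : C.geometricFibre.X.functionField}
    (hp : ∀ x : C.geometricFibre.ClosedPoint, C.projection x.1 = p.1 → Scheme.ord f x.1 = 1)
    (hq : ∀ x : C.geometricFibre.ClosedPoint, C.projection x.1 = q.1 → -1 ≤ Scheme.ord f x.1)
    (hf : ∀ x : C.geometricFibre.ClosedPoint, C.projection x.1 ≠ q.1 → 0 ≤ Scheme.ord f x.1) :
    ∃ h : C.X.functionField, Transcendental ℚ h ∧
      h ∈ PlaceFamily.space C.places (Finsupp.single q 1) := by
  let c := Module.Basis.ofVectorSpace ℚ Qbar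
  obtain ⟨t, ht⟩ := q.orderFunction.exists_ord_eq_one
  have ht0 : t ≠ 0 := q.orderFunction.ne_zero_of_ord_ne_zero (by rw [ht]; exact one_ne_zero)
  obtain ⟨hli, hw⟩ := exists_linearCombination_and_linearIndependent c q.1
  obtain ⟨w, hwf, hwq⟩ := hw (algebraMap C.X.functionField _ t * f) fun y hy => by
    refine (ClosedPoint.mem_filtration_zero_iff (closedPointOver q y hy)).mp ?_
    have h1 := algebraMap_mem_filtration_one q y hy (t := t) (Or.inr ht.ge)
    exact (closedPointOver q y hy).orderFunction.mul_mem_filtration (n := -1) h1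
      (Or.inr (hq _ hy))
  let v := t⁻¹ • w
  have hvf : f = Finsupp.linearCombination C.X.functionField
      (fun i => algebraMap Qbar C.geometricFibre.X.functionField (c i)) v := by
    rw [map_smul, ← hwf, Algebra.smul_def, map_inv₀, inv_mul_cancel_left₀]
    rwa [Ne, FaithfulSMul.algebraMap_eq_zero_iff]
  have hv (i) : v i ∈ PlaceFamily.space C.places (Finsupp.single q 1) := by
    refine (PlaceFamily.mem_space _).mpr fun x => ?_
    by_cases hx : x = q
    · subst hx
      rw [Finsupp.single_eq_same]
      have h1 := x.mem_filtration_zero_iff.mpr (hwq i)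
      exact x.orderFunction.mul_mem_filtration (m := -1) (f := t⁻¹)
        (Or.inr (by rw [OrderFunction.ord_inv, ht])) h1
    · rw [Finsupp.single_eq_of_ne hx]
      obtain ⟨u, huf, hux⟩ := (exists_linearCombination_and_linearIndependent c x.1).2 f
        fun y hy => by
          refine (ClosedPoint.mem_filtration_zero_iff (closedPointOver x y hy)).mp
            (Or.inr (hf _ fun h => hx (Subtype.ext (hy.symm.trans h))))
      have huv : u = v := hli (huf.symm.trans hvf)
      rw [← huv]
      exact x.mem_filtration_zero_iff.mpr (hux i)
  by_contra! hcon
  have halg (i) : IsAlgebraic Qbar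
      (algebraMap C.X.functionField C.geometricFibre.X.functionField (v i)) := by
    have h1 : IsAlgebraic ℚ (v i) := by
      by_contra h
      exact hcon (v i) h (hv i)
    exact h1.ringHom_of_comp_eq (algebraMap ℚ Qbar) (algebraMap C.X.functionField _)
      (algebraMap ℚ Qbar).injective (Subsingleton.elim _ _)
  have hfalg : IsAlgebraic Qbar f := by
    rw [hvf, Finsupp.linearCombination_apply]
    refine (Subalgebra.algebraicClosure Qbar C.geometricFibre.X.functionField).sum_mem
      fun i _ => ?_
    change IsAlgebraic Qbar (v i • _)
    rw [Algebra.smul_def]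
    exact (halg i).mul (isAlgebraic_algebraMap _)
  obtain ⟨y, hy⟩ := C.projection.surjective p.1
  refine (closedPointOver p y hy).orderFunction.transcendental_of_ord_ne_zero (f := f) ?_ hfalg
  exact (hp (closedPointOver p y hy) hy).trans_ne one_ne_zero

end Curve

namespace Curve

variable {C : Curve ℚ}

lemma finite_fibre (p : C.ClosedPoint) :
    {x : C.geometricFibre.ClosedPoint | C.projection x.1 = p.1}.Finite := by
  let U : C.X.Opens := ⟨{p.1}ᶜ, p.isClosed.isOpen_compl⟩
  refine (finite_notMem (C := C.geometricFibre) (U := C.projection ⁻¹ᵁ U) ?_).subset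
    fun x hx hxU => hxU hx
  change C.projection _ ∉ ({p.1} : Set C.X)
  rw [C.projection_genericPoint]
  exact fun h => p.ne_genericPoint h.symm

/-- The set of points of the geometric fibre over a closed point. -/
noncomputable def fibre (p : C.ClosedPoint) : Finset C.geometricFibre.ClosedPoint :=
  (finite_fibre p).toFinset

lemma mem_fibre {p : C.ClosedPoint} {x : C.geometricFibre.ClosedPoint} :
    x ∈ fibre p ↔ C.projection x.1 = p.1 := by simp [fibre]

/-- The pullback of a closed point to the geometric fibre. -/
noncomputable def fibreDivisor (p : C.ClosedPoint) : C.geometricFibre.Divisor :=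
  ∑ x ∈ fibre p, Finsupp.single x 1

open Classical in
lemma fibreDivisor_apply (p : C.ClosedPoint) (x : C.geometricFibre.ClosedPoint) :
    fibreDivisor p x = if C.projection x.1 = p.1 then 1 else 0 := by
  simp [fibreDivisor, Finsupp.finsetSum_apply, Finsupp.single_apply, mem_fibre]

lemma residueDegree_geometricFibre (x : C.geometricFibre.ClosedPoint) :
    C.geometricFibre.f.residueDegree x.1 = 1 := by
  rw [residueDegree_eq, finrank_eq_one_iff_of_nonzero' 1 one_ne_zero]
  have h : Function.Bijective (C.geometricFibre.residueConstants x.1).hom :=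
    IsAlgClosed.ringHom_bijective_of_isIntegral _
      ((algebraMap_isIntegral_iff (R := Qbar) (A := C.geometricFibre.X.residueField x.1)).mpr
        inferInstance)
  intro w
  obtain ⟨c, rfl⟩ := h.2 w
  exact ⟨c, by rw [Algebra.smul_def, mul_one]; rfl⟩

lemma degree_fibreDivisor (p : C.ClosedPoint) :
    C.geometricFibre.degree (fibreDivisor p) = (fibre p).card := by
  simp [fibreDivisor, degree, residueDegree_geometricFibre]

lemma galHom_projection (σ : Qbar ≃ₐ[ℚ] Qbar) : C.galHom σ ≫ C.projection = C.projection := by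
  exact (pullback.lift_fst _ _ _).trans (Category.comp_id _)

lemma projection_galPoint (σ : Qbar ≃ₐ[ℚ] Qbar) (x : C.geometricFibre.ClosedPoint) :
    C.projection (C.galPoint σ x).1 = C.projection x.1 := by
  change (C.galHom σ ≫ C.projection) x.1 = _
  rw [galHom_projection]

lemma galPoint_injective (σ : Qbar ≃ₐ[ℚ] Qbar) : Function.Injective (C.galPoint σ) :=
  fun _ _ h => Subtype.ext ((C.galHom σ).injective (congrArg Subtype.val h))

open Classical in
lemma galDivisor_fibreDivisor (σ : Qbar ≃ₐ[ℚ] Qbar) (p : C.ClosedPoint) :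
    C.galDivisor σ (fibreDivisor p) = fibreDivisor p := by
  have h : (fibre p).image (C.galPoint σ) = fibre p :=
    Finset.eq_of_subset_of_card_le (Finset.image_subset_iff.mpr fun x hx => by
      rwa [mem_fibre, projection_galPoint, ← mem_fibre])
      (Finset.card_image_of_injective _ (galPoint_injective σ)).ge
  conv_rhs => rw [fibreDivisor, ← h, Finset.sum_image (galPoint_injective σ).injOn]
  simp [fibreDivisor, galDivisor, Finsupp.mapDomain_single]

/-- The class of the difference of two fibres with the same number of points. -/
lemma mk_fibreDivisor_sub_mem_jacobianPoints {p q : C.ClosedPoint}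
    (h : (fibre p).card = (fibre q).card) :
    QuotientAddGroup.mk' C.geometricFibre.principalDivisors (fibreDivisor p - fibreDivisor q) ∈
      C.jacobianPoints := by
  refine AddSubgroup.mem_map_of_mem _ ⟨?_, fun σ => ?_⟩
  · rw [map_sub, degree_fibreDivisor, degree_fibreDivisor, h, sub_self]
  · rw [map_sub, galDivisor_fibreDivisor, galDivisor_fibreDivisor, sub_self]
    exact zero_mem _

lemma exists_eq_SpecMap_fromSpecResidueField {X : Scheme.{u}}
    {K : Type u} [Field K] (P : Spec (.of K) ⟶ X) {x : X}
    (hx : P (IsLocalRing.closedPoint K) = x) :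
    ∃ φ : X.residueField x ⟶ .of K, P = Spec.map φ ≫ X.fromSpecResidueField x := by
  subst hx
  exact ⟨_, ((Scheme.SpecToEquivOfField K X).left_inv P).symm⟩

/-- The point of a curve with values in the algebraic numbers given by a point of the geometric
fibre. -/
noncomputable def pointOfFibre (x : C.geometricFibre.ClosedPoint) : Spec (.of Qbar) ⟶ C.X :=
  pointOfClosedPoint C.geometricFibre.f x.1 x.isClosed ≫ C.projection

lemma pointOfFibre_apply (x : C.geometricFibre.ClosedPoint) :
    pointOfFibre x (IsLocalRing.closedPoint Qbar) = C.projection x.1 :=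
  congrArg C.projection (pointOfClosedPoint_apply C.geometricFibre.f x.1 x.isClosed _)

lemma pointOfFibre_injective :
    Function.Injective (pointOfFibre : C.geometricFibre.ClosedPoint → _) := by
  intro x y h
  have h1 : pointOfClosedPoint C.geometricFibre.f x.1 x.isClosed =
      pointOfClosedPoint C.geometricFibre.f y.1 y.isClosed :=
    C.isPullback_projection.hom_ext h (by simp)
  have h2 := congr($h1 (IsLocalRing.closedPoint Qbar))
  exact Subtype.ext ((pointOfClosedPoint_apply _ _ _ _).symm.trans
    (h2.trans (pointOfClosedPoint_apply _ _ _ _)))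

lemma card_fibre_le (p : C.ClosedPoint) :
    (fibre p).card ≤ Module.finrank ℚ (C.X.residueField p.1) := by
  choose φ hφ using fun x : fibre p => exists_eq_SpecMap_fromSpecResidueField
    (pointOfFibre x.1) ((pointOfFibre_apply x.1).trans (mem_fibre.mp x.2))
  have h : Function.Injective fun x => (φ x).hom.toRatAlgHom := by
    intro x y hxy
    have h1 : φ x = φ y := CommRingCat.hom_ext (RingHom.ext fun a => DFunLike.congr_fun hxy a)
    exact Subtype.ext (pointOfFibre_injective (by rw [hφ x, hφ y, h1]))
  have h2 := Nat.card_le_card_of_injective _ h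
  rw [Nat.card_eq_fintype_card, Fintype.card_coe] at h2
  exact h2.trans (card_algHom_le_finrank ℚ (C.X.residueField p.1) Qbar)

/-- If the Jacobian has finitely many rational points, then among infinitely many closed points of
bounded degree there is one that is the only pole, and a simple one, of some function. -/
theorem exists_transcendental_mem_space_of_infinite (hJ : Finite C.jacobianPoints)
    {S : Set C.ClosedPoint} (hS : S.Infinite) {d : ℕ}
    (hd : ∀ p ∈ S, Module.finrank ℚ (C.X.residueField p.1) ≤ d) :
    ∃ q ∈ S, ∃ h : C.X.functionField, Transcendental ℚ h ∧
      h ∈ PlaceFamily.space C.places (Finsupp.single q 1) := by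
  have := hS.to_subtype
  let n : S → Fin (d + 1) := fun p =>
    ⟨(fibre p.1).card, Nat.lt_succ_of_le ((card_fibre_le p.1).trans (hd p.1 p.2))⟩
  obtain ⟨k, hk⟩ := Finite.exists_infinite_fiber n
  have hcard (p q : n ⁻¹' {k}) : (fibre p.1.1).card = (fibre q.1.1).card :=
    congrArg Fin.val (p.2.trans q.2.symm)
  let o := Classical.arbitrary (n ⁻¹' {k})
  obtain ⟨q, p, hqp, h⟩ := Finite.exists_ne_map_eq_of_infinite fun p : n ⁻¹' {k} =>
    (⟨_, mk_fibreDivisor_sub_mem_jacobianPoints (hcard p o)⟩ : C.jacobianPoints)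
  obtain ⟨f, hf0, hf⟩ := QuotientAddGroup.eq.mp (congrArg Subtype.val h)
  have hord (x : C.geometricFibre.ClosedPoint) :
      Scheme.ord f x.1 = fibreDivisor p.1.1 x - fibreDivisor q.1.1 x := by
    rw [← hf x]
    simp only [Finsupp.add_apply, Finsupp.neg_apply, Finsupp.sub_apply]
    ring
  simp only [fibreDivisor_apply] at hord
  have hne : p.1.1.1 ≠ q.1.1.1 := fun h => hqp (Subtype.ext (Subtype.ext (Subtype.ext h))).symm
  obtain ⟨h, hh, hhq⟩ := exists_transcendental_mem_space (p := p.1.1) (q := q.1.1) (f := f)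
    (fun x hx => by rw [hord, if_pos hx, if_neg (by rwa [hx]), sub_zero])
    (fun x hx => by rw [hord, if_pos hx, if_neg (by rw [hx]; exact hne.symm), zero_sub])
    (fun x hx => by
      rw [hord, if_neg hx, sub_zero]
      split_ifs <;> norm_num)
  exact ⟨q.1.1, q.1.2, h, hh, hhq⟩

end Curve

namespace Curve

variable {C : Curve ℚ}

namespace AlgebraicPoint

variable (P : C.AlgebraicPoint)

/-- The image of an algebraic point. -/
noncomputable def image : C.X := (Scheme.SpecToEquivOfField Qbar C.X P.1).1

/-- The embedding of the residue field at the image of an algebraic point. -/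
noncomputable def residueEmbedding : C.X.residueField P.image →ₐ[ℚ] Qbar :=
  (Scheme.SpecToEquivOfField Qbar C.X P.1).2.hom.toRatAlgHom

lemma fieldRange_residueEmbedding : P.residueEmbedding.fieldRange = P.field := rfl

variable {P}

lemma HasDegree.finrank_residueField {d : ℕ} (h : P.HasDegree d) :
    Module.finrank ℚ (C.X.residueField P.image) = d :=
  (AlgEquiv.ofInjectiveField P.residueEmbedding).toLinearEquiv.finrank_eq.trans h

lemma IsPrimitive.eq_bot_or_eq_top (h : P.IsPrimitive)
    (L : IntermediateField ℚ (C.X.residueField P.image)) : L = ⊥ ∨ L = ⊤ := by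
  have h1 := h (L.map P.residueEmbedding)
  have hinj := IntermediateField.map_injective P.residueEmbedding
  have h2 : L.map P.residueEmbedding ≤ P.field := by
    rw [← fieldRange_residueEmbedding, AlgHom.fieldRange_eq_map]
    exact IntermediateField.map_mono _ le_top
  by_cases hbot : L.map P.residueEmbedding = ⊥
  · exact Or.inl (hinj (by rw [hbot, IntermediateField.map_bot]))
  · refine Or.inr (hinj ?_)
    rw [← AlgHom.fieldRange_eq_map, fieldRange_residueEmbedding]
    by_contra hne
    exact h1 ⟨bot_lt_iff_ne_bot.mpr hbot, lt_of_le_of_ne h2 hne⟩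

variable (P) in
lemma image_ne_genericPoint [Nonempty C.ClosedPoint]
    (h : 0 < Module.finrank ℚ (C.X.residueField P.image)) : P.image ≠ genericPoint C.X := by
  intro hP
  rw [hP] at h
  have := Module.finite_of_finrank_pos h
  obtain ⟨t, ht⟩ := (Classical.arbitrary C.ClosedPoint).orderFunction.exists_ord_eq_one
  refine (Classical.arbitrary C.ClosedPoint).orderFunction.transcendental_of_ord_ne_zero (f := t)
    (by rw [ht]; exact one_ne_zero) ?_
  have h1 : IsAlgebraic ℚ ((C.X.residue (genericPoint C.X)).hom t) :=
    Algebra.IsAlgebraic.isAlgebraic _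
  exact h1.of_ringHom_of_comp_eq (RingHom.id ℚ) (C.X.residue (genericPoint C.X)).hom
    Function.surjective_id (RingHom.injective _) (Subsingleton.elim _ _)

lemma finite_image_eq (p : C.ClosedPoint) : {P : C.AlgebraicPoint | P.image = p.1}.Finite := by
  choose φ hφ using fun P : {P : C.AlgebraicPoint | P.image = p.1} =>
    exists_eq_SpecMap_fromSpecResidueField P.1.1 P.2
  have h : Function.Injective fun P => (φ P).hom.toRatAlgHom := by
    intro P Q hPQ
    have h1 : φ P = φ Q := CommRingCat.hom_ext (RingHom.ext fun a => DFunLike.congr_fun hPQ a)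
    exact Subtype.ext (Subtype.ext (by rw [hφ P, hφ Q, h1]))
  have : Finite (C.X.residueField p.1 →ₐ[ℚ] Qbar) := inferInstance
  exact Finite.of_injective _ h

end AlgebraicPoint

/-- Finiteness of a set of points of a given degree satisfying a condition on their fields of
definition. -/
theorem Hom.Nonconstant.finite_algebraicPoints {C' : Curve ℚ} {π : C.Hom C'} (hπ : π.Nonconstant)
    (hg' : 1 ≤ C'.genus) (hJ : Finite C.jacobianPoints) {d : ℕ} (hd : 0 < d)
    (hgd : (π.deg : ℤ) * C'.genus + ((π.deg : ℤ) - 1) * ((d : ℤ) - 1) < C.genus)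
    {S : Set C.AlgebraicPoint} (hS : ∀ P ∈ S, P.HasDegree d)
    (hprim : (∀ P ∈ S, ∀ L : IntermediateField ℚ (C.X.residueField P.image), L = ⊥ ∨ L = ⊤) ∨
      Nat.gcd d π.deg = 1) : S.Finite := by
  have := hπ.nonempty_source
  have hm := hπ.deg_pos
  have hg : 1 ≤ C.genus := by
    zify at hm hd ⊢
    have h1 : 0 ≤ (π.deg : ℤ) * C'.genus := by positivity
    have h2 := mul_nonneg (sub_nonneg.mpr (Int.add_one_le_iff.mpr hm))
      (sub_nonneg.mpr (Int.add_one_le_iff.mpr hd))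
    simp only [zero_add] at h2
    linarith
  have hdeg (P : S) : Module.finrank ℚ (C.X.residueField P.1.image) = d :=
    (hS P.1 P.2).finrank_residueField
  let pt : S → C.ClosedPoint := fun P =>
    ⟨P.1.image, C.coheight_eq_one (P.1.image_ne_genericPoint (by rw [hdeg]; exact hd))⟩
  by_contra hinf
  have hrange : (Set.range pt).Infinite := by
    intro hfin
    refine hinf ?_
    have h1 := hfin.preimage' (f := pt) fun p _ => Set.Finite.of_finite_image
      (f := Subtype.val) ((AlgebraicPoint.finite_image_eq p).subset ?_) Subtype.val_injective.injOn
    · rw [Set.preimage_range] at h1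
      exact Set.finite_coe_iff.mp (Set.finite_univ_iff.mp h1)
    · rintro _ ⟨P, hP, rfl⟩
      exact congrArg Subtype.val hP
  obtain ⟨_, ⟨P, rfl⟩, h, hh, hhq⟩ := exists_transcendental_mem_space_of_infinite hJ hrange
    (d := d) (by rintro _ ⟨P, rfl⟩; exact (hdeg P).le)
  have hd' : Module.finrank ℚ (C.X.residueField (pt P).1) = d := hdeg P
  have hle := hπ.genus_le hg hg' hh hhq (hprim.imp (fun h => h P.1 P.2) fun h => by rwa [hd'])
  rw [hd'] at hle
  exact hle.not_gt hgd

end Curve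

theorem mainTheorem3 (C C' : Curve ℚ) (π : C.Hom C') (hπ : π.Nonconstant)
    (hg' : 1 ≤ C'.genus) (hJ : Finite C.jacobianPoints) (d : ℕ) (hd : 0 < d)
    (hgd : (π.deg : ℤ) * C'.genus + ((π.deg : ℤ) - 1) * ((d : ℤ) - 1) < C.genus) :
    {P : C.AlgebraicPoint | P.HasDegree d ∧ P.IsPrimitive}.Finite ∧
      ((Nat.gcd d π.deg = 1 ∨ d.Prime) → {P : C.AlgebraicPoint | P.HasDegree d}.Finite) := by
  refine ⟨hπ.finite_algebraicPoints hg' hJ hd hgd (fun P hP => hP.1)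
    (Or.inl fun P hP => hP.2.eq_bot_or_eq_top), fun h => ?_⟩
  refine hπ.finite_algebraicPoints hg' hJ hd hgd (fun P hP => hP)
    (h.symm.imp (fun hp P hP L => ?_) id)
  have := IntermediateField.isSimpleOrder_of_finrank_prime ℚ (C.X.residueField P.image)
    (by rwa [Curve.AlgebraicPoint.HasDegree.finrank_residueField hP])
  exact eq_bot_or_eq_top L
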